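/- Let $p\ge 1$ and let $\{X_t\}_{t\in\mathbb Z}$ be a strictly stationary and ergodic ARCH($p$) process, \[ X_t=\sigma_t(\theta_0)\varepsilon_t,\qquad \sigma_t^2(\theta)=\omega+\sum_{j=1}^p\alpha_j X_{t-j}^2,\qquad \theta=(\omega,\alpha_1,\dots,\alpha_p)^T, \] where the $\varepsilon_t$ are i.i.d. with $E\varepsilon_t=0$ and $E\varepsilon_t^2=1$, $\varepsilon_t$ is independent of $\{X_s:s<t\}$, and the true parameter $\theta_0=(\omega_0,\alpha_{01},\dots,\alpha_{0p})^T$ satisfies $\omega_0>0$, $\alpha_{0j}\ge 0$ and $\alpha_{0p}>0$. Put $Y_t=(1,X_t^2,\dots,X_{t-p+1}^2)^T$, so that $\sigma_t^2(\theta)=\theta^TY_{t-1}$. Assume: (i) $\theta_0$ lies in the interior of a compact parameter space $\Theta\subset(0,\infty)\times[0,\infty)^p$; (ii) the top Lyapunov exponent $\gamma=\inf_{t\ge1}\frac1t E\log\|A_1A_2\cdots A_t\|\in[-\infty,\infty)$ is negative, where $\|\cdot\|$ is the spectral norm and $A_t$ is the $p\times p$ matrix with first row $(\alpha_{01}\varepsilon_t^2,\dots,\alpha_{0p}\varepsilon_t^2)$,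 ones on the subdiagonal, and zeros elsewhere; (iii) $\varepsilon_t^2$ has a non-degenerate distribution; (iv) $E\varepsilon_t^4<\infty$; (v) $\Gamma(\theta_0)=E\bigl(Y_{t-1}Y_{t-1}^T/\sigma_t^4(\theta_0)\bigr)$ is finite. Let $\hat\theta_n^{LS}$ be the conditional least-squares estimator, given either as a (measurable) minimizer of $Q_n(\theta)=\sum_{t=1}^n(X_t^2-\theta^TY_{t-1})^2$ over $\Theta$, or in closed form as $(Y^TY)^{-1}Y^T(X_1^2,\dots,X_n^2)^T$, where $Y$ is the $n\times(p+1)$ matrix with $t$-th row $Y_{t-1}^T$. Assume that $\sqrt n(\hat\theta_n^{LS}-\theta_0)=O_p(1)$. Define \[ \hat\theta_n^{EF}=\Bigl(\sum_{t=1}^n\frac{Y_{t-1}Y_{t-1}^T}{\sigma_t^4(\hat\theta_n^{LS})}\Bigr)^{-1}\Bigl(\sum_{t=1}^n\frac{Y_{t-1}X_t^2}{\sigma_t^4(\hat\theta_n^{LS})}\Bigr) \] (with any fixed convention, here zero, for the inverse of a singular matrix and for division by zero). Then $\Gamma(\theta_0)$ is positive definite and, as $n\to\infty$, \[ \sqrt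 n(\hat\theta_n^{EF}-\theta_0)\xrightarrow{d}\mathcal N\bigl(0,\operatorname{Var}(\varepsilon_t^2)\,\Gamma^{-1}(\theta_0)\bigr). \] -/

import Mathlib

open MeasureTheory ProbabilityTheory Filter Topology

noncomputable section

namespace ARCH

variable {Ω : Type*}

/-- The volatility polynomial `σ_t²(θ) = ω + ∑_{j=1}^p α_j X_{t-j}²`, where `θ = (ω, α_1, …, α_p)`,
so that `θ 0 = ω` and `θ j.succ` is the coefficient of lag `j + 1` (`j = 0, …, p - 1`). -/
def sigmaSq {p : ℕ} (X : ℤ → Ω → ℝ) (θ : EuclideanSpace ℝ (Fin (p + 1))) (t : ℤ) (ω : Ω) : ℝ :=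
  θ 0 + ∑ j : Fin p, θ j.succ * X (t - 1 - (j : ℤ)) ω ^ 2

/-- The regressor `Y_t = (1, X_t², …, X_{t-p+1}²)ᵀ`. -/
def regressor (p : ℕ) (X : ℤ → Ω → ℝ) (t : ℤ) (ω : Ω) : Fin (p + 1) → ℝ :=
  Fin.cons 1 (fun j : Fin p => X (t - (j : ℤ)) ω ^ 2)

/-- The left shift on two-sided real sequences. -/
def shift (x : ℤ → ℝ) : ℤ → ℝ := fun t => x (t + 1)

/-- A two-sided real process is stationary and ergodic: the shift preserves its law on the space of
two-sided sequences and is ergodic for it. -/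
def IsStationaryErgodic [MeasurableSpace Ω] (μ : Measure Ω) (X : ℤ → Ω → ℝ) : Prop :=
  Ergodic shift (μ.map (fun ω t => X t ω))

/-- `X` is a stationary ergodic ARCH(p) process with parameter `θ₀` and innovations `ε`. -/
structure IsARCH [MeasurableSpace Ω] (μ : Measure Ω) (p : ℕ)
    (θ₀ : EuclideanSpace ℝ (Fin (p + 1))) (ε X : ℤ → Ω → ℝ) : Prop where
  measurable_innov : ∀ t, Measurable (ε t)
  innov_indep : iIndepFun ε μ
  innov_identDistrib : ∀ t, IdentDistrib (ε t) (ε 0) μ μ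
  innov_memLp_two : MemLp (ε 0) 2 μ
  innov_mean : ∫ ω, ε 0 ω ∂μ = 0
  innov_second_moment : ∫ ω, ε 0 ω ^ 2 ∂μ = 1
  omega_pos : 0 < θ₀ 0
  alpha_nonneg : ∀ j : Fin p, 0 ≤ θ₀ j.succ
  alpha_last_pos : 0 < θ₀ (Fin.last p)
  measurable_proc : ∀ t, Measurable (X t)
  /-- `ε_t` is independent of the family `(X_s)_{s < t}`. -/
  innov_indep_past : ∀ t : ℤ, IndepFun (ε t) (fun ω (s : Set.Iio t) => X s ω) μ
  equation : ∀ t, ∀ᵐ ω ∂μ, X t ω = √(sigmaSq X θ₀ t ω) * ε t ω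
  stationary_ergodic : IsStationaryErgodic μ X

/-- The random companion matrix as a function of the innovation `e`: first row
`(α_1 e², …, α_p e²)`, ones on the subdiagonal and zeros elsewhere. -/
def companion {p : ℕ} (θ : EuclideanSpace ℝ (Fin (p + 1))) (e : ℝ) : Matrix (Fin p) (Fin p) ℝ :=
  Matrix.of fun i j =>
    if (i : ℕ) = 0 then θ j.succ * e ^ 2 else if (i : ℕ) = (j : ℕ) + 1 then 1 else 0

/-- The spectral norm (operator norm for the Euclidean norm), with values in `[0, ∞]`. -/
def spectralENorm {p : ℕ} (M : Matrix (Fin p) (Fin p) ℝ) : ENNReal :=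
  ‖Matrix.toEuclideanCLM (n := Fin p) (𝕜 := ℝ) M‖ₑ

/-- The product `A_1 A_2 ⋯ A_t` of the random companion matrices. -/
def companionProd {p : ℕ} (θ : EuclideanSpace ℝ (Fin (p + 1))) (ε : ℤ → Ω → ℝ) (t : ℕ) (ω : Ω) :
    Matrix (Fin p) (Fin p) ℝ :=
  ((List.range t).map fun k => companion θ (ε ((k : ℤ) + 1) ω)).prod

/-- Expectation of an extended-real random variable, positive part minus negative part. It is used
only where the positive part has finite expectation. -/
def extExpectation [MeasurableSpace Ω] (μ : Measure Ω) (f : Ω → EReal) : EReal :=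
  ((∫⁻ ω, (f ω).toENNReal ∂μ : ENNReal) : EReal) - ((∫⁻ ω, (-f ω).toENNReal ∂μ : ENNReal) : EReal)

/-- The top Lyapunov exponent `γ = inf_{t ≥ 1} (1/t) E log ‖A_1 ⋯ A_t‖`, where `log 0 = -∞`, so that
`γ` is an element of `[-∞, ∞)`. -/
def lyapunovExponent [MeasurableSpace Ω] (μ : Measure Ω) {p : ℕ}
    (θ : EuclideanSpace ℝ (Fin (p + 1))) (ε : ℤ → Ω → ℝ) : EReal :=
  ⨅ (t : ℕ) (_ : 1 ≤ t),
    extExpectation μ (fun ω => ENNReal.log (spectralENorm (companionProd θ ε t ω))) / (t : EReal)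

/-- The random matrix `Y_{t-1} Y_{t-1}ᵀ / σ_t⁴(θ)`. -/
def weightedGram {p : ℕ} (X : ℤ → Ω → ℝ) (θ : EuclideanSpace ℝ (Fin (p + 1))) (t : ℤ) (ω : Ω) :
    Matrix (Fin (p + 1)) (Fin (p + 1)) ℝ :=
  (sigmaSq X θ t ω ^ 2)⁻¹ •
    Matrix.vecMulVec (regressor p X (t - 1) ω) (regressor p X (t - 1) ω)

/-- `Γ(θ) = E (Y_{t-1} Y_{t-1}ᵀ / σ_t⁴(θ))`, entrywise and at `t = 1`; by stationarity the choice
of `t` is immaterial. -/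
def Gam [MeasurableSpace Ω] (μ : Measure Ω) {p : ℕ} (X : ℤ → Ω → ℝ)
    (θ : EuclideanSpace ℝ (Fin (p + 1))) : Matrix (Fin (p + 1)) (Fin (p + 1)) ℝ :=
  Matrix.of fun i j => ∫ ω, weightedGram X θ 1 ω i j ∂μ

/-- Regularity conditions on the true parameter `θ₀`, the compact parameter space `Θ` and the
innovations. -/
structure Regular [MeasurableSpace Ω] (μ : Measure Ω) (p : ℕ)
    (Θ : Set (EuclideanSpace ℝ (Fin (p + 1)))) (θ₀ : EuclideanSpace ℝ (Fin (p + 1)))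
    (ε X : ℤ → Ω → ℝ) : Prop where
  compact : IsCompact Θ
  subset_pos : ∀ θ ∈ Θ, 0 < θ 0 ∧ ∀ j : Fin p, 0 ≤ θ j.succ
  mem_interior : θ₀ ∈ interior Θ
  lyapunov_neg : lyapunovExponent μ θ₀ ε < 0
  nondegenerate : ¬ ∃ c : ℝ, ∀ᵐ ω ∂μ, ε 0 ω ^ 2 = c
  fourth_moment : Integrable (fun ω => ε 0 ω ^ 4) μ
  gam_finite : ∀ i j, Integrable (fun ω => weightedGram X θ₀ 1 ω i j) μ

/-- The least-squares criterion `Q_n(θ) = ∑_{t=1}^n (X_t² - θᵀ Y_{t-1})²`. -/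
def lsCriterion {p : ℕ} (X : ℤ → Ω → ℝ) (n : ℕ) (ω : Ω) (θ : EuclideanSpace ℝ (Fin (p + 1))) : ℝ :=
  ∑ t ∈ Finset.Icc 1 n,
    (X (t : ℤ) ω ^ 2 - ∑ i, θ i * regressor p X ((t : ℤ) - 1) ω i) ^ 2

/-- The `n × (1 + p)` matrix with rows `Y_0, …, Y_{n-1}`. -/
def designMatrix (p : ℕ) (X : ℤ → Ω → ℝ) (n : ℕ) (ω : Ω) : Matrix (Fin n) (Fin (p + 1)) ℝ :=
  Matrix.of fun t => regressor p X ((t : ℕ) : ℤ) ω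

/-- The vector `(X_1², …, X_n²)ᵀ`. -/
def response (X : ℤ → Ω → ℝ) (n : ℕ) (ω : Ω) : Fin n → ℝ :=
  fun t => X (((t : ℕ) : ℤ) + 1) ω ^ 2

/-- The closed form `(YᵀY)⁻¹ Yᵀ X` of the least-squares estimator. The inverse of a singular matrix
is zero here; this does not affect the limit law, because `YᵀY` is invertible with probability
tending to one. -/
def lsClosedForm (p : ℕ) (X : ℤ → Ω → ℝ) (n : ℕ) (ω : Ω) : EuclideanSpace ℝ (Fin (p + 1)) :=
  let Y := designMatrix p X n ω
  WithLp.toLp 2 ((Y.transpose * Y)⁻¹.mulVec (Y.transpose.mulVec (response X n ω)))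

/-- `θLS` is a (conditional) least-squares estimator: a measurable selection of minimizers of `Q_n`
over `Θ`, or the closed form. -/
structure IsLSEstimator [MeasurableSpace Ω] (μ : Measure Ω) (p : ℕ)
    (Θ : Set (EuclideanSpace ℝ (Fin (p + 1)))) (X : ℤ → Ω → ℝ)
    (θLS : ℕ → Ω → EuclideanSpace ℝ (Fin (p + 1))) : Prop where
  aemeasurable : ∀ n, AEMeasurable (θLS n) μ
  spec : (∀ n, ∀ᵐ ω ∂μ, θLS n ω ∈ Θ ∧ IsMinOn (lsCriterion X n ω) Θ (θLS n ω)) ∨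
    (∀ n, ∀ᵐ ω ∂μ, θLS n ω = lsClosedForm p X n ω)

/-- `Z_n = O_p(1)`: boundedness in probability. -/
def IsBoundedInProbability [MeasurableSpace Ω] (μ : Measure Ω) {E : Type*} [Norm E]
    (Z : ℕ → Ω → E) : Prop :=
  ∀ δ : ℝ, 0 < δ → ∃ M : ℝ, ∀ᶠ n in atTop, μ {ω | M < ‖Z n ω‖} ≤ ENNReal.ofReal δ

/-- The estimating-function estimator
`(∑_{t=1}^n Y_{t-1} Y_{t-1}ᵀ / σ_t⁴(θ))⁻¹ (∑_{t=1}^n Y_{t-1} X_t² / σ_t⁴(θ))` with weights evaluated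
at a preliminary value `θ`. -/
def efEstimator {p : ℕ} (X : ℤ → Ω → ℝ) (n : ℕ) (θ : EuclideanSpace ℝ (Fin (p + 1))) (ω : Ω) :
    EuclideanSpace ℝ (Fin (p + 1)) :=
  WithLp.toLp 2 ((∑ t ∈ Finset.Icc 1 n, weightedGram X θ (t : ℤ) ω)⁻¹.mulVec
    (∑ t ∈ Finset.Icc 1 n,
      (X (t : ℤ) ω ^ 2 / sigmaSq X θ (t : ℤ) ω ^ 2) • regressor p X ((t : ℤ) - 1) ω))

end ARCH

end

noncomputable section

namespace ARCH

/-! Put V_k = Y_k / σ_{k+1}²(θ₀), η_k = X_{k+1}² / σ_{k+1}²(θ₀) - 1, which is almost surely ε_{k+1}²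
- 1, and let d be the error of the preliminary estimator. Since σ²(θ) / σ²(θ₀) = 1 + dᵀV and X² =
σ²(θ₀)(1 + η), the error of the final estimator is exactly M_n(d)⁻¹ g_n(d) whenever M_n(d) is
invertible, where M_n(d) averages V Vᵀ / (1 + dᵀV)² and g_n(d) averages η V / (1 + dᵀV)²
(`efEstimator_sub_eq`). An interior point of Θ has only positive coordinates (`Regular.param_pos`),
and θ₀ᵀV = 1 with nonnegative summands, so V is bounded (`abs_scaledRegressor_le`). This boundedness
makes every moment condition on the regressors harmless.

At d = 0 the mean ergodic theorem gives M_n(0) → Γ in L¹ (`IsARCH.tendsto_gram`), and √n g_n(0) is a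
normalised martingale with bounded predictable weights, asymptotically N(0, Var(ε²) Γ)
(`IsInnovation.tendsto_integral_cexp`, `tendstoInDistribution_score`).

Replacing 0 by d = O_p(n^{-1/2}) changes nothing in the limit. The matrix is Lipschitz in d. In the
score, the term linear in d is multiplied by averages of V_i V_j η, which vanish in probability
because martingale increments are orthogonal, and the quadratic term is O_p(1/n). A perturbation
bound for linear systems (`norm_inv_mulVec_sub_le`) and Slutsky's theorem conclude in
`tendstoInDistribution_of_linear_system`.

Γ is positive definite because a null direction would be a linear relation among 1, X_0², ...,
X_{1-p}²; solving it for the most recent square that occurs would make some ε_t² a function of the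
past, hence independent of itself and constant (`IsARCH.posDef_Gam`). -/

/-! ### Mean ergodic theorem in L¹ -/

/-- `L¹` convergence to zero implies convergence in probability to zero. -/
theorem tendstoInMeasure_of_tendsto_integral_abs {Ω : Type*} [MeasurableSpace Ω] {μ : Measure Ω}
    {Z : ℕ → Ω → ℝ} (hZ : ∀ n, Integrable (Z n) μ)
    (h : Tendsto (fun n => ∫ ω, |Z n ω| ∂μ) atTop (𝓝 0)) :
    TendstoInMeasure μ Z atTop (fun _ => 0) := by
  refine tendstoInMeasure_of_tendsto_eLpNorm (p := 1) one_ne_zero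
    (fun n => (hZ n).aestronglyMeasurable) aestronglyMeasurable_const ?_
  have := ENNReal.tendsto_ofReal h
  simp only [ENNReal.ofReal_zero] at this
  refine this.congr fun n => ?_
  rw [eLpNorm_one_eq_lintegral_enorm, ← ofReal_integral_norm_eq_lintegral_enorm]
  · simp
  · exact (hZ n).sub (integrable_zero _ _ _)

/-- The `L¹` norm of a real function is at most its `L²` norm on a probability space. -/
theorem integral_abs_le_norm_toLp {α : Type*} [MeasurableSpace α] {ν : Measure α}
    [IsProbabilityMeasure ν] (f : Lp ℝ 2 ν) : ∫ x, |f x| ∂ν ≤ ‖f‖ := by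
  have h1 : ∫ x, |f x| ∂ν = (eLpNorm f 1 ν).toReal := by
    rw [eLpNorm_one_eq_lintegral_enorm, ← integral_norm_eq_lintegral_enorm
      (Lp.aestronglyMeasurable f)]
    simp
  rw [h1, Lp.norm_def]
  exact ENNReal.toReal_mono (Lp.eLpNorm_ne_top f)
    (eLpNorm_le_eLpNorm_of_exponent_le (by norm_num) (Lp.aestronglyMeasurable f))

/-- Mean ergodic theorem in `L¹` for square integrable observables. -/
theorem tendsto_integral_abs_ergodic_average {α : Type*} [MeasurableSpace α] {ν : Measure α}
    [IsProbabilityMeasure ν] {f : α → α} (hf : Ergodic f ν) {g : α → ℝ} (hg : MemLp g 2 ν) :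
    Tendsto (fun n : ℕ => ∫ x, |(n : ℝ)⁻¹ * ∑ k ∈ Finset.range n, g (f^[k] x) - ∫ y, g y ∂ν| ∂ν)
      atTop (𝓝 0) := by
  have hmp := hf.toMeasurePreserving
  have hint : ∀ k, Integrable (fun x => g (f^[k] x)) ν := fun k =>
    (hmp.iterate k).integrable_comp_of_integrable (hg.integrable (by norm_num))
  -- The Koopman operator g ↦ g ∘ f is an isometry of L², so von Neumann's theorem sends its
  -- averages to the projection onto the fixed vectors.
  let T : Lp ℝ 2 ν →L[ℝ] Lp ℝ 2 ν :=
    (Lp.compMeasurePreservingₗᵢ ℝ f hmp).toContinuousLinearMap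
  have hT : ‖T‖ ≤ 1 := LinearIsometry.norm_toContinuousLinearMap_le _
  have hlim := T.tendsto_birkhoffAverage_orthogonalProjection hT (hg.toLp g)
  set P : Lp ℝ 2 ν := ((T.eqLocus (1 : Lp ℝ 2 ν →L[ℝ] Lp ℝ 2 ν)).orthogonalProjectionOnto
    (hg.toLp g) : Lp ℝ 2 ν) with hP
  have hPfix : T P = P :=
    ((T.eqLocus (1 : Lp ℝ 2 ν →L[ℝ] Lp ℝ 2 ν)).orthogonalProjectionOnto (hg.toLp g)).2
  -- A fixed vector of the Koopman operator is an invariant function, hence constant by ergodicity.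
  obtain ⟨c, hc⟩ : ∃ c, (P : α → ℝ) =ᵐ[ν] Function.const α c := by
    refine hf.ae_eq_const_of_ae_eq_comp_ae (Lp.aestronglyMeasurable P) ?_
    have h1 : (T P : α → ℝ) =ᵐ[ν] P ∘ f := Lp.coeFn_compMeasurePreserving P hmp
    rw [hPfix] at h1
    exact h1.symm
  have hiter : ∀ k, (T^[k] (hg.toLp g) : α → ℝ) =ᵐ[ν] fun x => g (f^[k] x) := by
    intro k
    have h1 : T^[k] (hg.toLp g) = Lp.compMeasurePreserving f^[k] (hmp.iterate k) (hg.toLp g) := by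
      rw [← Lp.compMeasurePreserving_iterate]; rfl
    rw [h1]
    refine (Lp.coeFn_compMeasurePreserving _ _).trans ?_
    exact (hmp.iterate k).quasiMeasurePreserving.ae_eq_comp hg.coeFn_toLp
  have havg : ∀ n : ℕ, ((birkhoffAverage ℝ T _root_.id n (hg.toLp g) : Lp ℝ 2 ν) : α → ℝ) =ᵐ[ν]
      fun x => (n : ℝ)⁻¹ * ∑ k ∈ Finset.range n, g (f^[k] x) := by
    intro n
    simp only [birkhoffAverage, birkhoffSum, id]
    have h2 := Lp.coeFn_smul (n : ℝ)⁻¹ (∑ k ∈ Finset.range n, T^[k] (hg.toLp g))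
    have h3 := Lp.coeFn_finsetSum (Finset.range n) (fun k => T^[k] (hg.toLp g))
    have h4 : ∀ᵐ x ∂ν, ∀ k, (T^[k] (hg.toLp g) : α → ℝ) x = g (f^[k] x) := ae_all_iff.2 hiter
    filter_upwards [h2, h3, h4] with x h2 h3 h4
    rw [h2]
    simp only [Pi.smul_apply, smul_eq_mul, h3, Finset.sum_apply, h4]
  have hc_lim : Tendsto (fun n : ℕ =>
      ∫ x, |(n : ℝ)⁻¹ * ∑ k ∈ Finset.range n, g (f^[k] x) - c| ∂ν) atTop (𝓝 0) := by
    have hn := (tendsto_iff_norm_sub_tendsto_zero).1 hlim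
    refine squeeze_zero (fun n => integral_nonneg fun _ => abs_nonneg _) (fun n => ?_) hn
    refine le_trans (le_of_eq (integral_congr_ae ?_)) (integral_abs_le_norm_toLp _)
    filter_upwards [Lp.coeFn_sub (birkhoffAverage ℝ T _root_.id n (hg.toLp g)) P, havg n, hc]
      with x h1 h2 h3
    rw [h1, Pi.sub_apply, h2, h3, Function.const_apply]
  -- For n > 0 every average has the same integral as g, and L¹ convergence preserves integrals;
  -- this identifies the constant.
  have hcint : c = ∫ y, g y ∂ν := by
    have hconst : Tendsto (fun n : ℕ =>
        |∫ x, ((n : ℝ)⁻¹ * ∑ k ∈ Finset.range n, g (f^[k] x) - c) ∂ν|) atTop (𝓝 0) :=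
      squeeze_zero (fun n => abs_nonneg _) (fun n => abs_integral_le_integral_abs) hc_lim
    have hev : ∀ᶠ n : ℕ in atTop,
        |∫ x, ((n : ℝ)⁻¹ * ∑ k ∈ Finset.range n, g (f^[k] x) - c) ∂ν| = |∫ y, g y ∂ν - c| := by
      filter_upwards [eventually_gt_atTop 0] with n hn
      have hk : ∀ k, ∫ x, g (f^[k] x) ∂ν = ∫ y, g y ∂ν := by
        intro k
        have h1 := (hmp.iterate k).map_eq
        conv_rhs => rw [← h1]
        rw [integral_map (hmp.iterate k).aemeasurable (by rw [h1]; exact hg.aestronglyMeasurable)]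
      rw [integral_sub ((integrable_finsetSum _ fun k _ => hint k).const_mul _)
        (integrable_const _), integral_const_mul, integral_finsetSum _ fun k _ => hint k]
      simp only [hk]
      have : (n : ℝ) ≠ 0 := by positivity
      simp [← mul_assoc, inv_mul_cancel₀ this]
    have := tendsto_nhds_unique (hconst.congr' hev) tendsto_const_nhds
    exact (sub_eq_zero.1 (abs_eq_zero.1 this.symm)).symm
  rwa [hcint] at hc_lim

/-! ### Martingale central limit theorem -/

/-- Characteristic functions of two laws with the same first two moments agree to second order
at the origin. -/
theorem charFun_sub_isLittleO {ν₁ ν₂ : Measure ℝ} [IsProbabilityMeasure ν₁]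
    [IsProbabilityMeasure ν₂] (h₁ : MemLp id 2 ν₁) (h₂ : MemLp id 2 ν₂)
    (hm : ∫ x, x ∂ν₁ = ∫ x, x ∂ν₂) (hs : ∫ x, x ^ 2 ∂ν₁ = ∫ x, x ^ 2 ∂ν₂) :
    (fun t => charFun ν₁ t - charFun ν₂ t) =o[𝓝 0] fun t : ℝ => t ^ 2 := by
  have e₁ := taylor_isLittleO_univ (x₀ := (0 : ℝ)) (n := 2) (contDiff_charFun h₁)
  have e₂ := taylor_isLittleO_univ (x₀ := (0 : ℝ)) (n := 2) (contDiff_charFun h₂)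
  have heq : ∀ t, taylorWithinEval (charFun ν₁) 2 Set.univ 0 t
      = taylorWithinEval (charFun ν₂) 2 Set.univ 0 t := by
    intro t
    rw [taylorWithinEval_charFun_zero h₁, taylorWithinEval_charFun_zero h₂]
    simp [Finset.sum_range_succ, hm, hs]
  have := e₁.sub e₂
  simp only [heq, sub_sub_sub_cancel_right, sub_zero] at this
  exact this

/-- Integrating out a variable independent of a sub-σ-algebra yields its characteristic
function. -/
theorem integral_mul_cexp_eq_integral_mul_charFun {Ω : Type*} {m m0 : MeasurableSpace Ω}
    {μ : Measure Ω} [IsProbabilityMeasure μ] (hm : m ≤ m0) {ξ : Ω → ℝ} (hξ : Measurable ξ)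
    (hind : Indep (MeasurableSpace.comap ξ inferInstance) m μ)
    {G : Ω → ℂ} (hG : Measurable[m] G) {C : ℝ} (hGC : ∀ ω, ‖G ω‖ ≤ C)
    {b : Ω → ℝ} (hb : Measurable[m] b) :
    ∫ ω, G ω * Complex.exp (b ω * ξ ω * Complex.I) ∂μ
      = ∫ ω, G ω * charFun (μ.map ξ) (b ω) ∂μ := by
  have hp : Measurable[m] fun ω => (G ω, b ω) := hG.prodMk hb
  have hp0 : Measurable fun ω => (G ω, b ω) := hp.mono hm le_rfl
  -- The pair (G, b) is measurable for the sub-σ-algebra, so it is independent of ξ jointly, and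
  -- Fubini may integrate ξ out with b frozen.
  have hindF : IndepFun (fun ω => (G ω, b ω)) ξ μ := by
    rw [IndepFun_iff_Indep]
    exact indep_of_indep_of_le_left hind.symm hp.comap_le
  have hmap := (indepFun_iff_map_prod_eq_prod_map_map hp0.aemeasurable hξ.aemeasurable).1 hindF
  have : IsProbabilityMeasure (μ.map ξ) := Measure.isProbabilityMeasure_map hξ.aemeasurable
  have : IsProbabilityMeasure (μ.map fun ω => (G ω, b ω)) :=
    Measure.isProbabilityMeasure_map hp0.aemeasurable
  let H : (ℂ × ℝ) × ℝ → ℂ := fun z => z.1.1 * Complex.exp (z.1.2 * z.2 * Complex.I)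
  have hH : Measurable H := by fun_prop
  have e1 : ∫ ω, G ω * Complex.exp (b ω * ξ ω * Complex.I) ∂μ
      = ∫ z, H z ∂((μ.map fun ω => (G ω, b ω)).prod (μ.map ξ)) := by
    rw [← hmap, integral_map (hp0.prodMk hξ).aemeasurable hH.aestronglyMeasurable]
  have hHint : Integrable H ((μ.map fun ω => (G ω, b ω)).prod (μ.map ξ)) := by
    rw [← hmap, integrable_map_measure hH.aestronglyMeasurable (hp0.prodMk hξ).aemeasurable]
    refine Integrable.of_bound (hH.comp (hp0.prodMk hξ)).aestronglyMeasurable C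
      (Eventually.of_forall fun ω => ?_)
    have : ‖Complex.exp (b ω * ξ ω * Complex.I)‖ = 1 := by
      rw [← Complex.ofReal_mul]; exact Complex.norm_exp_ofReal_mul_I _
    simp only [H, Function.comp, norm_mul, this, mul_one]
    exact hGC ω
  rw [e1, integral_prod H hHint]
  have e2 : ∀ z : ℂ × ℝ, ∫ y, H (z, y) ∂(μ.map ξ) = z.1 * charFun (μ.map ξ) z.2 := by
    intro z
    simp only [H, charFun_apply_real]
    rw [integral_const_mul]
  simp only [e2]
  rw [integral_map hp0.aemeasurable]
  exact (Measurable.mul measurable_fst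
    ((continuous_charFun.measurable).comp measurable_snd)).aestronglyMeasurable

/-- A sequence of centred, square integrable, identically distributed innovations, adapted to a
filtration with a delay of one step and independent of the past. -/
structure IsInnovation {Ω : Type*} [m0 : MeasurableSpace Ω] (μ : Measure Ω)
    (F : Filtration ℕ m0) (η : ℕ → Ω → ℝ) : Prop where
  measurable : ∀ k, Measurable[F (k + 1)] (η k)
  indep : ∀ k, Indep (MeasurableSpace.comap (η k) inferInstance) (F k) μ
  ident : ∀ k, IdentDistrib (η k) (η 0) μ μ
  memLp : MemLp (η 0) 2 μ
  mean : ∫ ω, η 0 ω ∂μ = 0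

namespace IsInnovation

variable {Ω : Type*} [m0 : MeasurableSpace Ω] {μ : Measure Ω}
  {F : Filtration ℕ m0} {η : ℕ → Ω → ℝ}

theorem measurable' (h : IsInnovation μ F η) (k : ℕ) : Measurable (η k) :=
  (h.measurable k).mono (F.le _) le_rfl

theorem memLp_two (h : IsInnovation μ F η) (k : ℕ) : MemLp (η k) 2 μ :=
  (h.ident k).symm.memLp_snd h.memLp

theorem integral_eq_zero (h : IsInnovation μ F η) (k : ℕ) : ∫ ω, η k ω ∂μ = 0 := by
  rw [(h.ident k).integral_eq, h.mean]

theorem integral_sq (h : IsInnovation μ F η) (k : ℕ) :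
    ∫ ω, η k ω ^ 2 ∂μ = ∫ ω, η 0 ω ^ 2 ∂μ :=
  ((h.ident k).comp (measurable_id.pow_const 2)).integral_eq

theorem measurable_sum (h : IsInnovation μ F η) {a : ℕ → Ω → ℝ}
    (ha : ∀ k, Measurable[F k] (a k)) (n : ℕ) :
    Measurable[F n] fun ω => ∑ k ∈ Finset.range n, a k ω * η k ω := by
  refine Finset.measurable_fun_sum _ fun k hk => ?_
  have hkn : k + 1 ≤ n := Finset.mem_range.1 hk
  exact (((ha k).mono (F.mono (by omega)) le_rfl)).mul ((h.measurable k).mono (F.mono hkn) le_rfl)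

theorem memLp_mul (h : IsInnovation μ F η) {a : ℕ → Ω → ℝ}
    (ha : ∀ k, Measurable[F k] (a k)) {C : ℝ} (haC : ∀ k ω, |a k ω| ≤ C) (k : ℕ) :
    MemLp (fun ω => a k ω * η k ω) 2 μ := by
  have hm : Measurable (a k) := (ha k).mono (F.le k) le_rfl
  refine ((h.memLp_two k).const_mul C).mono (hm.mul (h.measurable' k)).aestronglyMeasurable
    (Eventually.of_forall fun ω => ?_)
  simp only [norm_mul, Real.norm_eq_abs]
  exact mul_le_mul_of_nonneg_right ((haC k ω).trans (le_abs_self C)) (abs_nonneg _)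

/-- Orthogonality of martingale increments: the second moment of a weighted sum of innovations
grows at most linearly. -/
theorem integral_sum_sq_le (h : IsInnovation μ F η) {a : ℕ → Ω → ℝ}
    (ha : ∀ k, Measurable[F k] (a k)) {C : ℝ} (haC : ∀ k ω, |a k ω| ≤ C) (n : ℕ) :
    ∫ ω, (∑ k ∈ Finset.range n, a k ω * η k ω) ^ 2 ∂μ
      ≤ n * (C ^ 2 * ∫ ω, η 0 ω ^ 2 ∂μ) := by
  induction n with
  | zero => simp
  | succ n ih =>
    set S : Ω → ℝ := fun ω => ∑ k ∈ Finset.range n, a k ω * η k ω with hS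
    have hSm : Measurable[F n] S := h.measurable_sum ha n
    have hSL : MemLp S 2 μ := memLp_finsetSum _ fun k _ => h.memLp_mul ha haC k
    have hbL := h.memLp_mul ha haC n
    have ham : Measurable (a n) := (ha n).mono (F.le n) le_rfl
    -- The partial sum and the weight both belong to the past of step n, so they factor out against
    -- a centred innovation.
    have hcross : ∫ ω, S ω * (a n ω * η n ω) ∂μ = 0 := by
      have hind : IndepFun (fun ω => S ω * a n ω) (η n) μ := by
        rw [IndepFun_iff_Indep]
        exact indep_of_indep_of_le_left (h.indep n).symm (hSm.mul (ha n)).comap_le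
      have := hind.integral_fun_mul_eq_mul_integral
        ((hSm.mul (ha n)).mono (F.le n) le_rfl).aestronglyMeasurable
        (h.measurable' n).aestronglyMeasurable
      rw [h.integral_eq_zero n, mul_zero] at this
      simpa [mul_assoc] using this
    have hsq : ∫ ω, (a n ω * η n ω) ^ 2 ∂μ ≤ C ^ 2 * ∫ ω, η 0 ω ^ 2 ∂μ := by
      rw [← h.integral_sq n, ← integral_const_mul]
      refine integral_mono hbL.integrable_sq ((h.memLp_two n).integrable_sq.const_mul _)
        fun ω => ?_
      simp only [mul_pow]
      gcongr ?_ * _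
      rw [← sq_abs (a n ω)]
      exact pow_le_pow_left₀ (abs_nonneg _) (haC n ω) 2
    have hexp : ∫ ω, (∑ k ∈ Finset.range (n + 1), a k ω * η k ω) ^ 2 ∂μ
        = ∫ ω, S ω ^ 2 ∂μ + 2 * ∫ ω, S ω * (a n ω * η n ω) ∂μ
          + ∫ ω, (a n ω * η n ω) ^ 2 ∂μ := by
      have i1 := hSL.integrable_sq
      have i2 := (hSL.integrable_mul hbL).const_mul 2
      have i3 := hbL.integrable_sq
      simp only [Pi.mul_apply] at i2
      have i12 : Integrable (fun x => S x ^ 2 + 2 * (S x * (a n x * η n x))) μ := i1.add i2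
      rw [← integral_const_mul, ← integral_add i1 i2, ← integral_add i12 i3]
      refine integral_congr_ae (Eventually.of_forall fun ω => ?_)
      simp only [Finset.sum_range_succ, hS]
      ring
    rw [hexp, hcross]
    push_cast
    linarith

variable [IsProbabilityMeasure μ]

theorem integrable_sum (h : IsInnovation μ F η) {a : ℕ → Ω → ℝ}
    (ha : ∀ k, Measurable[F k] (a k)) {C : ℝ} (haC : ∀ k ω, |a k ω| ≤ C) (n : ℕ) :
    Integrable (fun ω => ∑ k ∈ Finset.range n, a k ω * η k ω) μ :=
  integrable_finsetSum _ fun k _ => (h.memLp_mul ha haC k).integrable (by norm_num)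

theorem integral_abs_sum_le (h : IsInnovation μ F η) {a : ℕ → Ω → ℝ}
    (ha : ∀ k, Measurable[F k] (a k)) {C : ℝ} (haC : ∀ k ω, |a k ω| ≤ C) (n : ℕ) :
    ∫ ω, |∑ k ∈ Finset.range n, a k ω * η k ω| ∂μ
      ≤ √n * √(C ^ 2 * ∫ ω, η 0 ω ^ 2 ∂μ) := by
  set S : Ω → ℝ := fun ω => ∑ k ∈ Finset.range n, a k ω * η k ω
  have hSL : MemLp S 2 μ := memLp_finsetSum _ fun k _ => h.memLp_mul ha haC k
  rw [← Real.sqrt_mul (by positivity)]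
  refine Real.le_sqrt_of_sq_le (le_trans ?_ (h.integral_sum_sq_le ha haC n))
  -- Nonnegativity of Var|S| is the inequality (E|S|)² ≤ E S².
  have hv := variance_nonneg (fun ω => |S ω|) μ
  have habs : MemLp (fun ω => |S ω|) 2 μ := hSL.abs
  rw [variance_eq_sub habs] at hv
  simp only [Pi.pow_apply, sq_abs] at hv
  linarith

/-- The exponential of a weighted sum of innovations, normalised by the Gaussian characteristic
functions of its predictable weights, has expectation close to one. -/
theorem norm_integral_normalized_cexp_sub_one_le (h : IsInnovation μ F η) {b : ℕ → Ω → ℝ}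
    (hb : ∀ k, Measurable[F k] (b k)) {B : ℝ} (hbB : ∀ k ω, |b k ω| ≤ B) {s δ : ℝ} (hs : 0 ≤ s)
    (hφ : ∀ u : ℝ, |u| ≤ B → ‖charFun (μ.map (η 0)) u - Complex.exp (-(s * u ^ 2 / 2 : ℝ))‖ ≤ δ)
    (n : ℕ) :
    ‖∫ ω, Complex.exp ((∑ k ∈ Finset.range n, b k ω * η k ω : ℝ) * Complex.I
        + (s / 2 * ∑ k ∈ Finset.range n, b k ω ^ 2 : ℝ)) ∂μ - 1‖
      ≤ n * (Real.exp (s / 2 * (n * B ^ 2)) * δ) := by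
  set T : ℕ → Ω → ℂ := fun m ω => Complex.exp
    ((∑ k ∈ Finset.range m, b k ω * η k ω : ℝ) * Complex.I
        + (s / 2 * ∑ k ∈ Finset.range m, b k ω ^ 2 : ℝ)) with hT
  have hb2 : ∀ m, Measurable[F m] fun ω => ∑ k ∈ Finset.range m, b k ω ^ 2 := fun m =>
    Finset.measurable_fun_sum _ fun k hk =>
      ((hb k).mono (F.mono (Finset.mem_range.1 hk).le) le_rfl).pow_const 2
  have hTm : ∀ m, Measurable[F m] (T m) := fun m => by
    have h1 := h.measurable_sum hb m
    have h2 := (hb2 m).const_mul (s / 2)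
    exact Complex.measurable_exp.comp
      (((Complex.measurable_ofReal.comp h1).mul_const _).add (Complex.measurable_ofReal.comp h2))
  have hnorm : ∀ m ω, ‖T m ω‖ = Real.exp (s / 2 * ∑ k ∈ Finset.range m, b k ω ^ 2) := by
    intro m ω
    simp only [hT, Complex.norm_exp]
    congr 1
    rw [Complex.add_re, Complex.re_ofReal_mul, Complex.I_re, mul_zero, zero_add, Complex.ofReal_re]
  have hsum : ∀ m, m ≤ n → ∀ ω, ∑ k ∈ Finset.range m, b k ω ^ 2 ≤ n * B ^ 2 := by
    intro m hm ω
    have h1 : ∑ k ∈ Finset.range m, b k ω ^ 2 ≤ ∑ _k ∈ Finset.range m, B ^ 2 :=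
      Finset.sum_le_sum fun k _ => by
        rw [← sq_abs (b k ω)]
        exact pow_le_pow_left₀ (abs_nonneg _) (hbB k ω) 2
    refine h1.trans ?_
    rw [Finset.sum_const, Finset.card_range, nsmul_eq_mul]
    gcongr
  have hTbound : ∀ m, m ≤ n → ∀ ω, ‖T m ω‖ ≤ Real.exp (s / 2 * (n * B ^ 2)) := by
    intro m hm ω
    rw [hnorm]
    exact Real.exp_le_exp.2 (mul_le_mul_of_nonneg_left (hsum m hm ω) (by positivity))
  suffices H : ∀ m, m ≤ n → ‖∫ ω, T m ω ∂μ - 1‖ ≤ m * (Real.exp (s / 2 * (n * B ^ 2)) * δ) from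
    H n le_rfl
  intro m
  induction m with
  | zero => intro _; simp [hT]
  | succ m ih =>
    intro hm
    -- G is the part of `T (m + 1)` known at time m. Multiplying G by exp(i b η) gives `T (m + 1)`,
    -- and multiplying it by the Gaussian factor gives `T m`; so one step costs at most sup|G| times
    -- the gap between the two characteristic functions.
    set G : Ω → ℂ := fun ω => T m ω * Complex.exp ((s / 2 * b m ω ^ 2 : ℝ)) with hG
    have hbm2 : Measurable[F m] fun ω => s / 2 * b m ω ^ 2 := ((hb m).pow_const 2).const_mul _
    have hGm : Measurable[F m] G :=
      (hTm m).mul (Complex.measurable_exp.comp (Complex.measurable_ofReal.comp hbm2))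
    have hGbound : ∀ ω, ‖G ω‖ ≤ Real.exp (s / 2 * (n * B ^ 2)) := by
      intro ω
      rw [hG, norm_mul, hnorm, ← Complex.ofReal_exp, Complex.norm_real, Real.norm_eq_abs,
        Real.abs_exp, ← Real.exp_add, ← mul_add, ← Finset.sum_range_succ (fun k => b k ω ^ 2)]
      exact Real.exp_le_exp.2 (mul_le_mul_of_nonneg_left (hsum _ hm ω) (by positivity))
    have hsucc : ∀ ω, T (m + 1) ω = G ω * Complex.exp (b m ω * η m ω * Complex.I) := by
      intro ω
      simp only [hG, hT, ← Complex.exp_add, Finset.sum_range_succ]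
      congr 1
      push_cast
      ring
    have hsame : ∀ ω, T m ω = G ω * Complex.exp (-(s * b m ω ^ 2 / 2 : ℝ)) := by
      intro ω
      simp only [hG, hT, ← Complex.exp_add]
      congr 1
      push_cast
      ring
    have hcond := integral_mul_cexp_eq_integral_mul_charFun (F.le m) (h.measurable' m) (h.indep m)
      hGm hGbound (hb m)
    rw [(h.ident m).map_eq] at hcond
    have : IsProbabilityMeasure (μ.map (η 0)) :=
      Measure.isProbabilityMeasure_map (h.measurable' 0).aemeasurable
    have hbm : Measurable (b m) := (hb m).mono (F.le m) le_rfl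
    have hG0 : Measurable G := hGm.mono (F.le m) le_rfl
    have hφm : Measurable fun ω => G ω * charFun (μ.map (η 0)) (b m ω) :=
      hG0.mul (continuous_charFun.measurable.comp hbm)
    have hTm0 : Measurable (T m) := (hTm m).mono (F.le m) le_rfl
    have hdiff : ‖∫ ω, T (m + 1) ω ∂μ - ∫ ω, T m ω ∂μ‖ ≤ Real.exp (s / 2 * (n * B ^ 2)) * δ := by
      simp only [hsucc]
      rw [hcond, ← integral_sub]
      · have hle : ∀ ω, ‖G ω * charFun (μ.map (η 0)) (b m ω) - T m ω‖
            ≤ Real.exp (s / 2 * (n * B ^ 2)) * δ := by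
          intro ω
          rw [hsame ω, ← mul_sub, norm_mul]
          exact mul_le_mul (hGbound ω) (hφ _ (hbB m ω)) (norm_nonneg _) (Real.exp_nonneg _)
        have := norm_integral_le_of_norm_le_const (μ := μ) (Eventually.of_forall hle)
        simpa using this
      · refine Integrable.of_bound hφm.aestronglyMeasurable (Real.exp (s / 2 * (n * B ^ 2)))
          (Eventually.of_forall fun ω => ?_)
        rw [norm_mul]
        exact (mul_le_of_le_one_right (norm_nonneg _) (norm_charFun_le_one _)).trans (hGbound ω)
      · exact Integrable.of_bound hTm0.aestronglyMeasurable _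
          (Eventually.of_forall (hTbound m (by omega)))
    have := ih (by omega)
    calc ‖∫ ω, T (m + 1) ω ∂μ - 1‖
        ≤ ‖∫ ω, T (m + 1) ω ∂μ - ∫ ω, T m ω ∂μ‖ + ‖∫ ω, T m ω ∂μ - 1‖ := norm_sub_le_norm_sub_add_norm_sub _ _ _
      _ ≤ _ := by push_cast; linarith

/-- Martingale central limit theorem, in the form of convergence of characteristic functions, for
innovations with bounded predictable weights whose squares satisfy a law of large numbers. -/
theorem tendsto_integral_cexp (h : IsInnovation μ F η) {a : ℕ → Ω → ℝ}
    (ha : ∀ k, Measurable[F k] (a k)) {C : ℝ} (haC : ∀ k ω, |a k ω| ≤ C) {v : ℝ} (hv : 0 ≤ v)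
    (hlln : Tendsto (fun n : ℕ => ∫ ω, |(n : ℝ)⁻¹ * ∑ k ∈ Finset.range n, a k ω ^ 2 - v| ∂μ)
      atTop (𝓝 0)) :
    Tendsto (fun n : ℕ => ∫ ω, Complex.exp
        (((√n)⁻¹ * ∑ k ∈ Finset.range n, a k ω * η k ω : ℝ) * Complex.I) ∂μ) atTop
      (𝓝 (Complex.exp (-((∫ ω, η 0 ω ^ 2 ∂μ) * v / 2 : ℝ)))) := by
  set s : ℝ := ∫ ω, η 0 ω ^ 2 ∂μ with hsdef
  have hs : 0 ≤ s := integral_nonneg fun _ => sq_nonneg _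
  have hC : 0 ≤ C := by
    obtain ⟨ω⟩ : Nonempty Ω := nonempty_of_isProbabilityMeasure μ
    exact (abs_nonneg _).trans (haC 0 ω)
  have hη := (h.measurable' 0).aemeasurable (μ := μ)
  have hprob : IsProbabilityMeasure (μ.map (η 0)) := Measure.isProbabilityMeasure_map hη
  -- The comparison law is the centred Gaussian of variance s, so the first two moments agree.
  have hlittle : (fun u : ℝ => charFun (μ.map (η 0)) u - Complex.exp (-(s * u ^ 2 / 2 : ℝ)))
      =o[𝓝 0] fun u : ℝ => u ^ 2 := by
    have h1 : MemLp id 2 (μ.map (η 0)) :=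
      (memLp_map_measure_iff aestronglyMeasurable_id hη).2 h.memLp
    have h2 : MemLp id 2 (gaussianReal 0 s.toNNReal) := memLp_id_gaussianReal 2
    have h3 : ∫ x, x ∂(μ.map (η 0)) = ∫ x, x ∂(gaussianReal 0 s.toNNReal) := by
      rw [integral_map (f := fun x : ℝ => x) hη aestronglyMeasurable_id, h.mean,
        integral_id_gaussianReal]
    have h4 : ∫ x, x ^ 2 ∂(μ.map (η 0)) = ∫ x, x ^ 2 ∂(gaussianReal 0 s.toNNReal) := by
      rw [integral_map hη (by fun_prop), ← hsdef]
      have := variance_eq_sub h2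
      rw [variance_id_gaussianReal] at this
      simp only [Pi.pow_apply, id, integral_id_gaussianReal, Real.coe_toNNReal _ hs] at this
      linarith
    refine (charFun_sub_isLittleO h1 h2 h3 h4).congr_left fun u => ?_
    rw [charFun_gaussianReal, Real.coe_toNNReal _ hs]
    congr 2
    push_cast
    ring
  -- After scaling the weights by n^{-1/2} their squares sum to at most C², so K bounds the
  -- normalising factor uniformly in n.
  set K : ℝ := Real.exp (s / 2 * C ^ 2) with hK
  have hψ : ‖Complex.exp (-(s * v / 2 : ℝ))‖ ≤ 1 := by
    rw [← Complex.ofReal_neg, ← Complex.ofReal_exp, Complex.norm_real, Real.norm_eq_abs,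
      Real.abs_exp, Real.exp_le_one_iff]
    have := mul_nonneg hs hv
    linarith
  rw [Metric.tendsto_atTop']
  intro ε hε
  -- Each of the n steps will cost K γ C² / n, hence K C² γ in total.
  obtain ⟨γ, hγ, hγε⟩ : ∃ γ : ℝ, 0 < γ ∧ K * (C ^ 2 * γ) ≤ ε / 4 := by
    refine ⟨ε / 4 / (K * (C ^ 2 + 1)), by positivity, ?_⟩
    have hKpos : 0 < K := Real.exp_pos _
    rw [← mul_assoc, mul_div_assoc', div_le_iff₀ (by positivity)]
    nlinarith [mul_pos hKpos hε]
  have hsmall := hlittle.def hγ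
  obtain ⟨r, hr, hball⟩ := Metric.eventually_nhds_iff.1 hsmall
  have hKpos : 0 < K := Real.exp_pos _
  have hlim1 : Tendsto (fun n : ℕ => (√n)⁻¹ * C) atTop (𝓝 0) := by
    rw [← zero_mul C]
    exact (tendsto_inv_atTop_zero.comp
      (Real.tendsto_sqrt_atTop.comp tendsto_natCast_atTop_atTop)).mul_const C
  have hlim2 : Tendsto (fun n : ℕ => K * (s / 2) *
      ∫ ω, |(n : ℝ)⁻¹ * ∑ k ∈ Finset.range n, a k ω ^ 2 - v| ∂μ) atTop (𝓝 0) := by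
    simpa using hlln.const_mul (K * (s / 2))
  have hev := (hlim1.eventually (gt_mem_nhds hr)).and
    ((hlim2.eventually (gt_mem_nhds (by positivity : 0 < ε / 4))).and (eventually_gt_atTop 0))
  obtain ⟨N, hN⟩ := eventually_atTop.1 hev
  refine ⟨N, fun n hn => ?_⟩
  obtain ⟨hn1, hn2, hn0⟩ := hN n hn.le
  have hnR : (0 : ℝ) < n := by exact_mod_cast hn0
  set b : ℕ → Ω → ℝ := fun k ω => (√n)⁻¹ * a k ω with hbdef
  have hb : ∀ k, Measurable[F k] (b k) := fun k => (ha k).const_mul _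
  have hbB : ∀ k ω, |b k ω| ≤ (√n)⁻¹ * C := fun k ω => by
    rw [hbdef, abs_mul, abs_of_nonneg (by positivity : (0 : ℝ) ≤ (√n)⁻¹)]
    exact mul_le_mul_of_nonneg_left (haC k ω) (by positivity)
  have hBsq : n * ((√n)⁻¹ * C) ^ 2 = C ^ 2 := by
    rw [mul_pow, inv_pow, Real.sq_sqrt hnR.le, ← mul_assoc, mul_inv_cancel₀ hnR.ne', one_mul]
  have hφ : ∀ u : ℝ, |u| ≤ (√n)⁻¹ * C →
      ‖charFun (μ.map (η 0)) u - Complex.exp (-(s * u ^ 2 / 2 : ℝ))‖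
        ≤ γ * ((√n)⁻¹ * C) ^ 2 := by
    intro u hu
    refine (hball (by rw [Real.dist_eq, sub_zero]; exact hu.trans_lt hn1)).trans ?_
    rw [Real.norm_eq_abs, abs_of_nonneg (sq_nonneg u), ← sq_abs u]
    gcongr
  have hmain := h.norm_integral_normalized_cexp_sub_one_le hb hbB hs hφ n
  rw [hBsq, ← hK] at hmain
  have hmain' : n * (K * (γ * ((√n)⁻¹ * C) ^ 2)) = K * (C ^ 2 * γ) := by
    rw [← hBsq]; ring
  rw [hmain'] at hmain
  set A : Ω → ℝ := fun ω => (n : ℝ)⁻¹ * ∑ k ∈ Finset.range n, a k ω ^ 2 with hA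
  set T : Ω → ℂ := fun ω => Complex.exp ((∑ k ∈ Finset.range n, b k ω * η k ω : ℝ) * Complex.I
        + (s / 2 * ∑ k ∈ Finset.range n, b k ω ^ 2 : ℝ)) with hT
  have hbsum : ∀ ω, ∑ k ∈ Finset.range n, b k ω ^ 2 = A ω := by
    intro ω
    simp only [hbdef, hA, mul_pow, inv_pow, Real.sq_sqrt hnR.le, Finset.mul_sum]
  have hA0 : ∀ ω, 0 ≤ A ω := fun ω => by
    rw [← hbsum]; exact Finset.sum_nonneg fun _ _ => sq_nonneg _
  have hAC : ∀ ω, A ω ≤ C ^ 2 := by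
    intro ω
    rw [← hbsum, ← hBsq]
    have h1 : ∑ k ∈ Finset.range n, b k ω ^ 2 ≤ ∑ _k ∈ Finset.range n, ((√n)⁻¹ * C) ^ 2 :=
      Finset.sum_le_sum fun k _ => by
        rw [← sq_abs (b k ω)]
        exact pow_le_pow_left₀ (abs_nonneg _) (hbB k ω) 2
    simpa using h1
  have hTK : ∀ ω, ‖T ω‖ ≤ K := by
    intro ω
    rw [hT, Complex.norm_exp, Complex.add_re, Complex.re_ofReal_mul, Complex.I_re, mul_zero,
      zero_add, Complex.ofReal_re, hbsum]
    exact Real.exp_le_exp.2 (mul_le_mul_of_nonneg_left (hAC ω) (by positivity))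
  have hAm : Measurable A := by
    refine (Finset.measurable_fun_sum _ fun k _ => ?_).const_mul _
    exact ((ha k).mono (F.le k) le_rfl).pow_const 2
  have hSm : Measurable fun ω => ∑ k ∈ Finset.range n, b k ω * η k ω :=
    (h.measurable_sum hb n).mono (F.le n) le_rfl
  have hTm : Measurable T := by
    have : T = fun ω => Complex.exp ((∑ k ∈ Finset.range n, b k ω * η k ω : ℝ) * Complex.I
        + (s / 2 * A ω : ℝ)) := by
      funext ω; simp only [hT, hbsum]
    rw [this]
    exact Complex.measurable_exp.comp (((Complex.measurable_ofReal.comp hSm).mul_const _).add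
      (Complex.measurable_ofReal.comp (hAm.const_mul _)))
  set ψ : ℂ := Complex.exp (-(s * v / 2 : ℝ)) with hψdef
  set P : Ω → ℂ := fun ω => Complex.exp (-(s * A ω / 2 : ℝ)) with hP
  have hPm : Measurable P := Complex.measurable_exp.comp
    (Complex.measurable_ofReal.comp ((hAm.const_mul s).div_const 2)).neg
  have hPψ : ∀ ω, ‖P ω - ψ‖ ≤ s / 2 * |A ω - v| := by
    intro ω
    simp only [hP, hψdef]
    rw [← Complex.ofReal_neg, ← Complex.ofReal_neg, ← Complex.ofReal_exp,
      ← Complex.ofReal_exp, ← Complex.ofReal_sub, Complex.norm_real, Real.norm_eq_abs]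
    have hlip : ∀ x y : ℝ, 0 ≤ x → 0 ≤ y → |Real.exp (-x) - Real.exp (-y)| ≤ |x - y| := by
      intro x y hx hy
      have key : ∀ x y : ℝ, 0 ≤ x → x ≤ y → Real.exp (-x) - Real.exp (-y) ≤ y - x := by
        intro x y hx hxy
        have h1 := Real.add_one_le_exp (x - y)
        have h2 : Real.exp (-y) = Real.exp (-x) * Real.exp (x - y) := by
          rw [← Real.exp_add]; ring_nf
        have h3 : Real.exp (-x) ≤ 1 := Real.exp_le_one_iff.2 (by linarith)
        have h4 := Real.exp_pos (-x)
        rw [h2]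
        nlinarith
      rcases le_total x y with hxy | hxy
      · rw [abs_of_nonneg (sub_nonneg.2 (Real.exp_le_exp.2 (by linarith))),
          abs_of_nonpos (by linarith)]
        linarith [key x y hx hxy]
      · rw [abs_of_nonpos (sub_nonpos.2 (Real.exp_le_exp.2 (by linarith))),
          abs_of_nonneg (by linarith)]
        linarith [key y x hy hxy]
    refine (hlip _ _ (by have := hA0 ω; positivity) (by positivity)).trans (le_of_eq ?_)
    rw [show s * A ω / 2 - s * v / 2 = s / 2 * (A ω - v) by ring, abs_mul,
      abs_of_nonneg (by positivity : 0 ≤ s / 2)]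
  have hAint : Integrable (fun ω => |A ω - v|) μ := by
    refine Integrable.abs (Integrable.sub ?_ (integrable_const _))
    exact Integrable.of_bound hAm.aestronglyMeasurable (C ^ 2) (Eventually.of_forall fun ω => by
      rw [Real.norm_eq_abs, abs_of_nonneg (hA0 ω)]; exact hAC ω)
  have hTint : Integrable T μ :=
    Integrable.of_bound hTm.aestronglyMeasurable K (Eventually.of_forall hTK)
  have hprodle : ∀ ω, ‖T ω * (P ω - ψ)‖ ≤ K * (s / 2) * |A ω - v| := by
    intro ω
    rw [norm_mul, mul_assoc]
    exact mul_le_mul (hTK ω) (hPψ ω) (norm_nonneg _) hKpos.le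
  have hTPint : Integrable (fun ω => T ω * (P ω - ψ)) μ :=
    (hAint.const_mul _).mono' (hTm.mul (hPm.sub_const _)).aestronglyMeasurable
      (Eventually.of_forall hprodle)
  -- The normaliser of T is random; P is its exact inverse and ψ the limit of P. The first term is
  -- small by the law of large numbers for the squared weights, the second by the telescoping bound.
  have hsplit : ∫ ω, Complex.exp
      (((√n)⁻¹ * ∑ k ∈ Finset.range n, a k ω * η k ω : ℝ) * Complex.I) ∂μ - ψ
      = ∫ ω, T ω * (P ω - ψ) ∂μ + ψ * (∫ ω, T ω ∂μ - 1) := by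
    have hpt : ∀ ω, Complex.exp
        (((√n)⁻¹ * ∑ k ∈ Finset.range n, a k ω * η k ω : ℝ) * Complex.I)
        = T ω * (P ω - ψ) + ψ * T ω := by
      intro ω
      have : T ω * (P ω - ψ) + ψ * T ω = T ω * P ω := by ring
      rw [this]
      simp only [hT, hP, ← Complex.exp_add, hbsum]
      congr 1
      have : ∑ k ∈ Finset.range n, b k ω * η k ω
          = (√n)⁻¹ * ∑ k ∈ Finset.range n, a k ω * η k ω := by
        simp only [hbdef, Finset.mul_sum, mul_assoc]
      rw [this]
      push_cast
      ring
    simp only [hpt]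
    rw [integral_add hTPint (hTint.const_mul _), integral_const_mul]
    ring
  rw [dist_eq_norm, hsplit]
  have hfirst : ‖∫ ω, T ω * (P ω - ψ) ∂μ‖ ≤ K * (s / 2) * ∫ ω, |A ω - v| ∂μ := by
    rw [← integral_const_mul]
    exact norm_integral_le_of_norm_le (hAint.const_mul _) (Eventually.of_forall hprodle)
  have hsecond : ‖ψ * (∫ ω, T ω ∂μ - 1)‖ ≤ K * (C ^ 2 * γ) := by
    rw [norm_mul]
    exact (mul_le_of_le_one_left (norm_nonneg _) hψ).trans hmain
  have := norm_add_le (∫ ω, T ω * (P ω - ψ) ∂μ) (ψ * (∫ ω, T ω ∂μ - 1))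
  linarith

end IsInnovation

/-! ### Calculus of O_p(1) and o_p(1) -/

section StochasticOrder

variable {Ω : Type*} [MeasurableSpace Ω] {μ : Measure Ω}

theorem isBoundedInProbability_const (c : ℝ) :
    IsBoundedInProbability μ (fun (_ : ℕ) (_ : Ω) => c) := fun δ _ =>
  ⟨‖c‖, Eventually.of_forall fun _ => by simp⟩

theorem IsBoundedInProbability.norm {E : Type*} [NormedAddCommGroup E] {Z : ℕ → Ω → E}
    (hZ : IsBoundedInProbability μ Z) : IsBoundedInProbability μ (fun n ω => ‖Z n ω‖) := by
  intro δ hδ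
  obtain ⟨M, hM⟩ := hZ δ hδ
  exact ⟨M, by simpa using hM⟩

variable [IsProbabilityMeasure μ]

theorem tendstoInMeasure_zero_iff {E : Type*} [NormedAddCommGroup E] {Z : ℕ → Ω → E} :
    TendstoInMeasure μ Z atTop (fun _ => 0) ↔
      ∀ ε, 0 < ε → Tendsto (fun n => μ.real {ω | ε ≤ ‖Z n ω‖}) atTop (𝓝 0) := by
  simp [tendstoInMeasure_iff_measureReal_norm]

theorem TendstoInMeasure.add_zero {Y Z : ℕ → Ω → ℝ} (hY : TendstoInMeasure μ Y atTop (fun _ => 0))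
    (hZ : TendstoInMeasure μ Z atTop (fun _ => 0)) :
    TendstoInMeasure μ (fun n ω => Y n ω + Z n ω) atTop (fun _ => 0) := by
  rw [tendstoInMeasure_zero_iff] at *
  intro ε hε
  have h := (hY (ε / 2) (by positivity)).add (hZ (ε / 2) (by positivity))
  rw [_root_.add_zero] at h
  refine squeeze_zero (fun _ => measureReal_nonneg) (fun n => ?_) h
  refine le_trans (measureReal_mono ?_) (measureReal_union_le _ _)
  intro ω hω
  simp only [Set.mem_ofPred_eq, Set.mem_union] at *
  by_contra! hcon
  have := norm_add_le (Y n ω) (Z n ω)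
  linarith

theorem TendstoInMeasure.finset_sum_zero {ι : Type*} {s : Finset ι} {Z : ι → ℕ → Ω → ℝ}
    (hZ : ∀ i ∈ s, TendstoInMeasure μ (Z i) atTop (fun _ => 0)) :
    TendstoInMeasure μ (fun n ω => ∑ i ∈ s, Z i n ω) atTop (fun _ => 0) := by
  classical
  induction s using Finset.induction_on with
  | empty =>
    rw [tendstoInMeasure_zero_iff]
    intro ε hε
    simp [hε.not_ge]
  | insert i s hi ih =>
    simp only [Finset.sum_insert hi]
    exact TendstoInMeasure.add_zero (hZ i (Finset.mem_insert_self i s))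
      (ih fun j hj => hZ j (Finset.mem_insert_of_mem hj))

/-- Allows a deterministic estimate that is valid only on the event `A n ω ≤ c`: the complement has
vanishing probability because A is o_p(1). -/
theorem TendstoInMeasure.of_eventually_norm_le {E : Type*} [NormedAddCommGroup E]
    {D : ℕ → Ω → E} {A R : ℕ → Ω → ℝ} (hA : TendstoInMeasure μ A atTop (fun _ => 0))
    (hR : TendstoInMeasure μ R atTop (fun _ => 0)) {c : ℝ} (hc : 0 < c)
    (hD : ∀ᶠ n in atTop, ∀ ω, A n ω ≤ c → ‖D n ω‖ ≤ R n ω) :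
    TendstoInMeasure μ D atTop (fun _ => 0) := by
  rw [tendstoInMeasure_zero_iff] at *
  intro ε hε
  have h := (hA c hc).add (hR ε hε)
  rw [_root_.add_zero] at h
  refine squeeze_zero' (Eventually.of_forall fun _ => measureReal_nonneg) ?_ h
  filter_upwards [hD] with n hn
  refine le_trans (measureReal_mono ?_) (measureReal_union_le _ _)
  intro ω hω
  simp only [Set.mem_ofPred_eq, Set.mem_union] at *
  by_cases hAc : A n ω ≤ c
  · exact Or.inr ((hω.trans (hn ω hAc)).trans (le_abs_self _))
  · exact Or.inl ((not_le.1 hAc).le.trans (le_abs_self _))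

theorem TendstoInMeasure.abs_zero {Z : ℕ → Ω → ℝ} (hZ : TendstoInMeasure μ Z atTop (fun _ => 0)) :
    TendstoInMeasure μ (fun n ω => |Z n ω|) atTop (fun _ => 0) := by
  rw [tendstoInMeasure_zero_iff] at *
  simpa using hZ

theorem IsBoundedInProbability.mul_tendstoInMeasure_zero {Y Z : ℕ → Ω → ℝ}
    (hY : IsBoundedInProbability μ Y) (hZ : TendstoInMeasure μ Z atTop (fun _ => 0)) :
    TendstoInMeasure μ (fun n ω => Y n ω * Z n ω) atTop (fun _ => 0) := by
  rw [tendstoInMeasure_zero_iff] at *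
  intro ε hε
  rw [Metric.tendsto_atTop']
  intro δ hδ
  -- Half of δ pays for the event that Y exceeds M; off that event Z must exceed ε / (|M| + 1),
  -- which pays the other half. Using |M| + 1 avoids any sign condition on M.
  obtain ⟨M, hM⟩ := hY (δ / 2) (by positivity)
  have h := (hZ (ε / (|M| + 1)) (by positivity)).eventually (gt_mem_nhds (half_pos hδ))
  obtain ⟨N, hN⟩ := eventually_atTop.1 (hM.and h)
  refine ⟨N, fun n hn => ?_⟩
  obtain ⟨h1, h2⟩ := hN n hn.le
  have h1' : μ.real {ω | M < ‖Y n ω‖} ≤ δ / 2 :=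
    ENNReal.toReal_le_of_le_ofReal (by positivity) h1
  have hsub : {ω | ε ≤ ‖Y n ω * Z n ω‖} ⊆
      {ω | M < ‖Y n ω‖} ∪ {ω | ε / (|M| + 1) ≤ ‖Z n ω‖} := by
    intro ω hω
    simp only [Set.mem_ofPred_eq, Set.mem_union, norm_mul] at *
    by_contra! hcon
    obtain ⟨hc1, hc2⟩ := hcon
    rw [lt_div_iff₀ (by positivity)] at hc2
    have := le_abs_self M
    nlinarith [norm_nonneg (Z n ω)]
  rw [Real.dist_eq, sub_zero, abs_of_nonneg measureReal_nonneg]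
  have h3 := (measureReal_mono (μ := μ) hsub).trans (measureReal_union_le _ _)
  linarith

theorem TendstoInMeasure.const_mul_zero {Z : ℕ → Ω → ℝ}
    (hZ : TendstoInMeasure μ Z atTop (fun _ => 0)) (c : ℝ) :
    TendstoInMeasure μ (fun n ω => c * Z n ω) atTop (fun _ => 0) :=
  (isBoundedInProbability_const c).mul_tendstoInMeasure_zero hZ

theorem tendstoInMeasure_zero_of_tendsto {z : ℕ → ℝ} (hz : Tendsto z atTop (𝓝 0)) :
    TendstoInMeasure μ (fun n (_ : Ω) => z n) atTop (fun _ => 0) :=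
  tendstoInMeasure_of_tendsto_ae (fun _ => aestronglyMeasurable_const)
    (Eventually.of_forall fun _ => hz)

/-- Markov's inequality, with |K| + 1 in place of K so that the threshold is strictly positive. -/
theorem isBoundedInProbability_of_integral_abs_le {Z : ℕ → Ω → ℝ} {K : ℝ}
    (hZ : ∀ n, Integrable (Z n) μ) (hK : ∀ᶠ n in atTop, ∫ ω, |Z n ω| ∂μ ≤ K) :
    IsBoundedInProbability μ Z := by
  intro δ hδ
  refine ⟨(|K| + 1) / δ, ?_⟩
  filter_upwards [hK] with n hn
  have h := mul_meas_ge_le_integral_of_nonneg (μ := μ) (Eventually.of_forall fun ω => abs_nonneg _)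
    (hZ n).abs ((|K| + 1) / δ)
  rw [← ofReal_measureReal]
  refine ENNReal.ofReal_le_ofReal ?_
  have hsub : μ.real {ω | (|K| + 1) / δ < ‖Z n ω‖} ≤ μ.real {ω | (|K| + 1) / δ ≤ |Z n ω|} :=
    measureReal_mono fun ω (hω : _ < ‖Z n ω‖) => show _ ≤ |Z n ω| from hω.le
  refine hsub.trans ?_
  rw [div_mul_eq_mul_div, div_le_iff₀ hδ] at h
  have := le_abs_self K
  have hp : 0 < |K| + 1 := by positivity
  have h4 : (|K| + 1) * μ.real {ω | (|K| + 1) / δ ≤ |Z n ω|} ≤ (|K| + 1) * δ := by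
    nlinarith
  exact le_of_mul_le_mul_left h4 hp

end StochasticOrder

/-! ### Perturbation of linear systems -/

section LinearAlgebra

open scoped Matrix.Norms.Operator

variable {ι : Type*} [Fintype ι] [DecidableEq ι]

/-- Perturbation of the solution of a linear system, relative to an invertible matrix `Γ`. -/
theorem norm_inv_mulVec_sub_le {Γ M : Matrix ι ι ℝ} (hΓ : IsUnit Γ.det) {δ : ℝ}
    (hδ : ‖Γ⁻¹‖ * ‖M - Γ‖ ≤ δ) (hδ2 : δ ≤ 1 / 2) (g g₀ : ι → ℝ) :
    IsUnit M.det ∧ ‖M⁻¹.mulVec g - Γ⁻¹.mulVec g₀‖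
      ≤ 2 * (‖Γ⁻¹‖ * ‖g - g₀‖) + 2 * δ * ‖Γ⁻¹.mulVec g₀‖ := by
  have hE : Γ⁻¹ * M - 1 = Γ⁻¹ * (M - Γ) := by
    rw [mul_sub, Matrix.nonsing_inv_mul _ hΓ]
  have hEn : ‖Γ⁻¹ * M - 1‖ ≤ δ := by
    rw [hE]; exact (Matrix.linfty_opNorm_mul _ _).trans hδ
  have hEv : ∀ x : ι → ℝ, ‖(Γ⁻¹ * M - 1).mulVec x‖ ≤ δ * ‖x‖ := fun x =>
    (Matrix.linfty_opNorm_mulVec _ _).trans (mul_le_mul_of_nonneg_right hEn (norm_nonneg _))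
  have hM : IsUnit M.det := by
    -- A null vector x of M would satisfy ‖x‖ ≤ δ‖x‖ with δ ≤ 1/2.
    rw [isUnit_iff_ne_zero]
    intro hdet
    obtain ⟨x, hx0, hx⟩ := Matrix.exists_mulVec_eq_zero_iff.2 hdet
    have h1 := hEv x
    rw [Matrix.sub_mulVec, ← Matrix.mulVec_mulVec, hx, Matrix.mulVec_zero, Matrix.one_mulVec,
      zero_sub, norm_neg] at h1
    have : 0 < ‖x‖ := norm_pos_iff.2 hx0
    nlinarith
  refine ⟨hM, ?_⟩
  set x := M⁻¹.mulVec g with hx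
  set v := Γ⁻¹.mulVec g₀ with hv
  have hMx : M.mulVec x = g := by
    rw [hx, Matrix.mulVec_mulVec, Matrix.mul_nonsing_inv _ hM, Matrix.one_mulVec]
  -- With E = Γ⁻¹M - 1 this reads x - v = Γ⁻¹(g - g₀) - E x. Bounding ‖x‖ by ‖x - v‖ + ‖v‖ and
  -- absorbing δ‖x - v‖ into the left side produces the factors 2.
  have hdiff : x - v = Γ⁻¹.mulVec (g - g₀) - (Γ⁻¹ * M - 1).mulVec x := by
    rw [Matrix.sub_mulVec, ← Matrix.mulVec_mulVec, hMx, Matrix.one_mulVec, Matrix.mulVec_sub, ← hv]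
    abel
  have h1 : ‖x - v‖ ≤ ‖Γ⁻¹‖ * ‖g - g₀‖ + δ * ‖x‖ := by
    rw [hdiff]
    exact (norm_sub_le _ _).trans (add_le_add (Matrix.linfty_opNorm_mulVec _ _) (hEv x))
  have h2 : ‖x‖ ≤ ‖x - v‖ + ‖v‖ := by simpa using norm_add_le (x - v) v
  have hδ0 : 0 ≤ δ := (norm_nonneg _).trans hEn
  nlinarith [norm_nonneg (x - v), norm_nonneg v]

theorem linfty_opNorm_le_sum (A : Matrix ι ι ℝ) : ‖A‖ ≤ ∑ i, ∑ j, |A i j| := by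
  have h : ‖A‖₊ ≤ ∑ i, ∑ j, ‖A i j‖₊ := by
    rw [Matrix.linfty_opNNNorm_def]
    exact Finset.sup_le fun i hi =>
      Finset.single_le_sum (f := fun i => ∑ j, ‖A i j‖₊) (fun _ _ => zero_le) hi
  have := NNReal.coe_le_coe.2 h
  simpa using this

end LinearAlgebra

theorem pi_norm_le_sum {ι : Type*} [Fintype ι] (x : ι → ℝ) : ‖x‖ ≤ ∑ i, |x i| :=
  (pi_norm_le_iff_of_nonneg (Finset.sum_nonneg fun _ _ => abs_nonneg _)).2 fun i =>
    Finset.single_le_sum (f := fun i => |x i|) (fun _ _ => abs_nonneg _) (Finset.mem_univ i)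

/-! ### Expansion of the weighted averages in the preliminary error -/

section WeightedScore

variable {ι : Type*} [Fintype ι]

/-- The average of `V_k V_kᵀ / (1 + dᵀ V_k)²` over `k < n`. -/
def avgGram (V : ℕ → ι → ℝ) (d : ι → ℝ) (n : ℕ) : Matrix ι ι ℝ :=
  Matrix.of fun i j =>
    (n : ℝ)⁻¹ * ∑ k ∈ Finset.range n, V k i * V k j / (1 + ∑ l, d l * V k l) ^ 2

/-- The average of `η_k V_k / (1 + dᵀ V_k)²` over `k < n`. -/
def avgScore (V : ℕ → ι → ℝ) (η : ℕ → ℝ) (d : ι → ℝ) (n : ℕ) : ι → ℝ := fun i =>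
  (n : ℝ)⁻¹ * ∑ k ∈ Finset.range n, V k i * η k / (1 + ∑ l, d l * V k l) ^ 2

/-- The difference equals -u(2 + u)/(1 + u)², where 2 + u ≤ 5/2 and (1 + u)² ≥ 1/4; this gives 10.
-/
theorem abs_inv_sq_sub_one_le {u : ℝ} (hu : |u| ≤ 1 / 2) : |1 / (1 + u) ^ 2 - 1| ≤ 10 * |u| := by
  obtain ⟨h1, h2⟩ := abs_le.1 hu
  have hpos : 1 / 4 ≤ (1 + u) ^ 2 := by nlinarith
  have hne : 1 + u ≠ 0 := (by linarith : 0 < 1 + u).ne'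
  have : 1 / (1 + u) ^ 2 - 1 = -(u * (2 + u)) / (1 + u) ^ 2 := by field_simp; ring
  rw [this, abs_div, abs_neg, abs_mul, abs_of_nonneg (sq_nonneg (1 + u)),
    abs_of_nonneg (by linarith : 0 ≤ 2 + u), div_le_iff₀ (by positivity)]
  nlinarith [abs_nonneg u]

/-- The remainder equals u²(3 + 2u)/(1 + u)², where 3 + 2u ≤ 4 and (1 + u)² ≥ 1/4; this gives 16. -/
theorem abs_inv_sq_sub_taylor_le {u : ℝ} (hu : |u| ≤ 1 / 2) :
    |1 / (1 + u) ^ 2 - 1 + 2 * u| ≤ 16 * u ^ 2 := by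
  obtain ⟨h1, h2⟩ := abs_le.1 hu
  have hpos : 1 / 4 ≤ (1 + u) ^ 2 := by nlinarith
  have hne : 1 + u ≠ 0 := (by linarith : 0 < 1 + u).ne'
  have : 1 / (1 + u) ^ 2 - 1 + 2 * u = u ^ 2 * (3 + 2 * u) / (1 + u) ^ 2 := by field_simp; ring
  rw [this, abs_div, abs_mul, abs_of_nonneg (sq_nonneg (1 + u)), abs_of_nonneg (sq_nonneg u),
    abs_of_nonneg (by linarith : 0 ≤ 3 + 2 * u), div_le_iff₀ (by positivity)]
  nlinarith [sq_nonneg u]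

variable {V : ℕ → ι → ℝ} {η : ℕ → ℝ} {d : ι → ℝ} {C D : ℝ}

theorem abs_sum_mul_le (hV : ∀ k i, |V k i| ≤ C) (hd : ∀ i, |d i| ≤ D) (k : ℕ) :
    |∑ l, d l * V k l| ≤ Fintype.card ι * (D * C) := by
  refine (Finset.abs_sum_le_sum_abs _ _).trans ?_
  have : ∀ l ∈ Finset.univ, |d l * V k l| ≤ D * C := fun l _ => by
    rw [abs_mul]
    exact mul_le_mul (hd l) (hV k l) (abs_nonneg _) ((abs_nonneg _).trans (hd l))
  refine (Finset.sum_le_card_nsmul _ _ _ this).trans ?_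
  simp

theorem abs_avg_le {f : ℕ → ℝ} {K : ℝ} {n : ℕ} (hn : 0 < n) (h : ∀ k, |f k| ≤ K) :
    |(n : ℝ)⁻¹ * ∑ k ∈ Finset.range n, f k| ≤ K := by
  have hn' : (0 : ℝ) < n := by exact_mod_cast hn
  rw [abs_mul, abs_of_nonneg (by positivity : (0 : ℝ) ≤ (n : ℝ)⁻¹), inv_mul_le_iff₀ hn']
  refine (Finset.abs_sum_le_sum_abs _ _).trans ?_
  refine (Finset.sum_le_card_nsmul _ _ _ fun k _ => h k).trans ?_
  simp

theorem abs_avgGram_sub_le (hV : ∀ k i, |V k i| ≤ C) (hd : ∀ i, |d i| ≤ D)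
    (hsmall : Fintype.card ι * (D * C) ≤ 1 / 2) {n : ℕ} (hn : 0 < n) (i j : ι) :
    |avgGram V d n i j - avgGram V 0 n i j| ≤ C ^ 2 * (10 * (Fintype.card ι * (D * C))) := by
  have hC : 0 ≤ C := (abs_nonneg _).trans (hV 0 i)
  have heq : avgGram V d n i j - avgGram V 0 n i j = (n : ℝ)⁻¹ * ∑ k ∈ Finset.range n,
      V k i * V k j * (1 / (1 + ∑ l, d l * V k l) ^ 2 - 1) := by
    simp only [avgGram, Matrix.of_apply, Pi.zero_apply, zero_mul, Finset.sum_const_zero, add_zero,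
      one_pow, div_one]
    rw [← mul_sub, ← Finset.sum_sub_distrib]
    congr 1
    exact Finset.sum_congr rfl fun k _ => by ring
  rw [heq]
  refine abs_avg_le hn fun k => ?_
  have hu := abs_sum_mul_le hV hd k
  rw [abs_mul, abs_mul, pow_two C]
  exact mul_le_mul (mul_le_mul (hV k i) (hV k j) (abs_nonneg _) hC)
    ((abs_inv_sq_sub_one_le (hu.trans hsmall)).trans (by linarith)) (abs_nonneg _) (by positivity)

/-- A first-order bound would leave √n · O_p(n^{-1/2}), which does not vanish. Hence the linear term
keeps its signed sums over k, whose cancellation is used later, and absolute values enter inside the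
sum only in the quadratic remainder. -/
theorem abs_avgScore_sub_le (hV : ∀ k i, |V k i| ≤ C) (hd : ∀ i, |d i| ≤ D)
    (hsmall : Fintype.card ι * (D * C) ≤ 1 / 2) (n : ℕ) (i : ι) :
    |avgScore V η d n i - avgScore V η 0 n i|
      ≤ 2 * (D * ∑ j, |(n : ℝ)⁻¹ * ∑ k ∈ Finset.range n, V k i * V k j * η k|)
        + C * (16 * (Fintype.card ι * (D * C)) ^ 2) *
          ((n : ℝ)⁻¹ * ∑ k ∈ Finset.range n, |η k|) := by
  have hC : 0 ≤ C := (abs_nonneg _).trans (hV 0 i)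
  have heq : avgScore V η d n i - avgScore V η 0 n i
      = -2 * ∑ j, d j * ((n : ℝ)⁻¹ * ∑ k ∈ Finset.range n, V k i * V k j * η k)
        + (n : ℝ)⁻¹ * ∑ k ∈ Finset.range n, V k i *
          (1 / (1 + ∑ l, d l * V k l) ^ 2 - 1 + 2 * ∑ l, d l * V k l) * η k := by
    have h1 : ∑ j, d j * ((n : ℝ)⁻¹ * ∑ k ∈ Finset.range n, V k i * V k j * η k)
        = (n : ℝ)⁻¹ * ∑ k ∈ Finset.range n, V k i * (∑ l, d l * V k l) * η k := by
      simp only [Finset.mul_sum, Finset.sum_mul]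
      rw [Finset.sum_comm]
      exact Finset.sum_congr rfl fun k _ => Finset.sum_congr rfl fun j _ => by ring
    rw [h1]
    simp only [avgScore, Pi.zero_apply, zero_mul, Finset.sum_const_zero, add_zero, one_pow, div_one]
    rw [← mul_sub, ← Finset.sum_sub_distrib, mul_left_comm (-2 : ℝ), ← mul_add,
      Finset.mul_sum _ _ (-2 : ℝ), ← Finset.sum_add_distrib]
    congr 1
    exact Finset.sum_congr rfl fun k _ => by ring
  rw [heq]
  refine (abs_add_le _ _).trans (add_le_add ?_ ?_)
  · rw [abs_mul, abs_neg, abs_two, Finset.mul_sum]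
    refine mul_le_mul_of_nonneg_left ((Finset.abs_sum_le_sum_abs _ _).trans ?_) (by norm_num)
    refine Finset.sum_le_sum fun j _ => ?_
    rw [abs_mul]
    exact mul_le_mul_of_nonneg_right (hd j) (abs_nonneg _)
  · rw [abs_mul, abs_of_nonneg (by positivity : (0 : ℝ) ≤ (n : ℝ)⁻¹), mul_left_comm]
    refine mul_le_mul_of_nonneg_left ((Finset.abs_sum_le_sum_abs _ _).trans ?_) (by positivity)
    rw [Finset.mul_sum]
    refine Finset.sum_le_sum fun k _ => ?_
    have hu := abs_sum_mul_le hV hd k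
    rw [abs_mul, abs_mul]
    refine mul_le_mul_of_nonneg_right ?_ (abs_nonneg _)
    refine mul_le_mul (hV k i) ((abs_inv_sq_sub_taylor_le (hu.trans hsmall)).trans ?_)
      (abs_nonneg _) hC
    rw [← sq_abs]
    gcongr

end WeightedScore

/-! ### Asymptotic normality in abstract form -/

section AbstractScore

variable {Ω : Type*} [m0 : MeasurableSpace Ω] {μ : Measure Ω} [IsProbabilityMeasure μ]
  {F : Filtration ℕ m0} {η : ℕ → Ω → ℝ} {ι : Type*} [Fintype ι]
  {V : ℕ → Ω → ι → ℝ} {C : ℝ}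

theorem avgScore_zero_apply (V : ℕ → ι → ℝ) (η : ℕ → ℝ) (n : ℕ) (i : ι) :
    avgScore V η 0 n i = (n : ℝ)⁻¹ * ∑ k ∈ Finset.range n, V k i * η k := by
  simp [avgScore]

theorem avgGram_zero_apply (V : ℕ → ι → ℝ) (n : ℕ) (i j : ι) :
    avgGram V 0 n i j = (n : ℝ)⁻¹ * ∑ k ∈ Finset.range n, V k i * V k j := by
  simp [avgGram]

/-- The Cramér–Wold input: the squared scalar weights wᵀV are a fixed linear combination of the
entries of V Vᵀ, so entrywise convergence suffices. -/
theorem tendsto_integral_abs_avg_linear_sq {Γ : Matrix ι ι ℝ}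
    (hVm : ∀ k i, Measurable fun ω => V k ω i) (hVC : ∀ k ω i, |V k ω i| ≤ C)
    (hlln : ∀ i j, Tendsto (fun n : ℕ =>
      ∫ ω, |(n : ℝ)⁻¹ * ∑ k ∈ Finset.range n, V k ω i * V k ω j - Γ i j| ∂μ) atTop (𝓝 0))
    (w : ι → ℝ) :
    Tendsto (fun n : ℕ => ∫ ω, |(n : ℝ)⁻¹ * ∑ k ∈ Finset.range n, (∑ i, w i * V k ω i) ^ 2
      - w ⬝ᵥ Γ.mulVec w| ∂μ) atTop (𝓝 0) := by
  have hint : ∀ i j (n : ℕ), Integrable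
      (fun ω => |(n : ℝ)⁻¹ * ∑ k ∈ Finset.range n, V k ω i * V k ω j - Γ i j|) μ := by
    intro i j n
    refine (Integrable.sub (Integrable.const_mul (integrable_finsetSum _ fun k _ => ?_) _)
      (integrable_const _)).abs
    refine Integrable.of_bound ((hVm k i).mul (hVm k j)).aestronglyMeasurable (C * C)
      (Eventually.of_forall fun ω => ?_)
    rw [Real.norm_eq_abs, abs_mul]
    exact mul_le_mul (hVC k ω i) (hVC k ω j) (abs_nonneg _) ((abs_nonneg _).trans (hVC k ω i))
  have hlim : Tendsto (fun n : ℕ => ∑ i, ∑ j, |w i * w j| *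
      ∫ ω, |(n : ℝ)⁻¹ * ∑ k ∈ Finset.range n, V k ω i * V k ω j - Γ i j| ∂μ) atTop (𝓝 0) := by
    have := tendsto_finsetSum (Finset.univ : Finset ι) fun i _ =>
      tendsto_finsetSum (Finset.univ : Finset ι) fun j _ => (hlln i j).const_mul |w i * w j|
    simpa using this
  refine squeeze_zero (fun n => integral_nonneg fun _ => abs_nonneg _) (fun n => ?_) hlim
  have hrhs : ∑ i, ∑ j, |w i * w j| *
      ∫ ω, |(n : ℝ)⁻¹ * ∑ k ∈ Finset.range n, V k ω i * V k ω j - Γ i j| ∂μ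
      = ∫ ω, ∑ i, ∑ j, |w i * w j| *
        |(n : ℝ)⁻¹ * ∑ k ∈ Finset.range n, V k ω i * V k ω j - Γ i j| ∂μ := by
    rw [integral_finsetSum _ fun i _ => integrable_finsetSum _ fun j _ => (hint i j n).const_mul _]
    refine Finset.sum_congr rfl fun i _ => ?_
    rw [integral_finsetSum _ fun j _ => (hint i j n).const_mul _]
    exact Finset.sum_congr rfl fun j _ => (integral_const_mul _ _).symm
  rw [hrhs]
  refine integral_mono_of_nonneg (Eventually.of_forall fun _ => abs_nonneg _)
    (integrable_finsetSum _ fun i _ => integrable_finsetSum _ fun j _ => (hint i j n).const_mul _)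
    (Eventually.of_forall fun ω => ?_)
  have hexp : (n : ℝ)⁻¹ * ∑ k ∈ Finset.range n, (∑ i, w i * V k ω i) ^ 2 - w ⬝ᵥ Γ.mulVec w
      = ∑ i, ∑ j, (w i * w j) *
        ((n : ℝ)⁻¹ * ∑ k ∈ Finset.range n, V k ω i * V k ω j - Γ i j) := by
    have h1 : ∀ k, (∑ i, w i * V k ω i) ^ 2
        = ∑ i, ∑ j, (w i * w j) * (V k ω i * V k ω j) := by
      intro k
      rw [pow_two, Finset.sum_mul_sum]
      exact Finset.sum_congr rfl fun i _ => Finset.sum_congr rfl fun j _ => by ring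
    have h2 : w ⬝ᵥ Γ.mulVec w = ∑ i, ∑ j, (w i * w j) * Γ i j := by
      simp only [dotProduct, Matrix.mulVec, Finset.mul_sum]
      exact Finset.sum_congr rfl fun i _ => Finset.sum_congr rfl fun j _ => by ring
    have h3 : ∑ k ∈ Finset.range n, ∑ i, ∑ j, (w i * w j) * (V k ω i * V k ω j)
        = ∑ i, ∑ j, (w i * w j) * ∑ k ∈ Finset.range n, V k ω i * V k ω j := by
      rw [Finset.sum_comm]
      refine Finset.sum_congr rfl fun i _ => ?_
      rw [Finset.sum_comm]
      exact Finset.sum_congr rfl fun j _ => by rw [Finset.mul_sum]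
    simp only [h1, h2, h3]
    rw [Finset.mul_sum, ← Finset.sum_sub_distrib]
    refine Finset.sum_congr rfl fun i _ => ?_
    rw [Finset.mul_sum, ← Finset.sum_sub_distrib]
    exact Finset.sum_congr rfl fun j _ => by ring
  simp only [hexp]
  refine (Finset.abs_sum_le_sum_abs _ _).trans (Finset.sum_le_sum fun i _ => ?_)
  refine (Finset.abs_sum_le_sum_abs _ _).trans (Finset.sum_le_sum fun j _ => ?_)
  rw [abs_mul]

variable [DecidableEq ι]

/-- Central limit theorem for the standardised score. -/
theorem tendstoInDistribution_score (h : IsInnovation μ F η)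
    (hVm : ∀ k i, Measurable[F k] fun ω => V k ω i) (hVC : ∀ k ω i, |V k ω i| ≤ C)
    {Γ : Matrix ι ι ℝ} (hΓ : Γ.PosDef)
    (hlln : ∀ i j, Tendsto (fun n : ℕ =>
      ∫ ω, |(n : ℝ)⁻¹ * ∑ k ∈ Finset.range n, V k ω i * V k ω j - Γ i j| ∂μ) atTop (𝓝 0)) :
    TendstoInDistribution
      (fun (n : ℕ) ω => (WithLp.toLp 2 (Γ⁻¹.mulVec
        (√(n : ℝ) • avgScore (fun k => V k ω) (fun k => η k ω) 0 n)) : EuclideanSpace ℝ ι))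
      atTop (id : EuclideanSpace ℝ ι → EuclideanSpace ℝ ι) (fun _ => μ)
      (multivariateGaussian 0 ((∫ ω, η 0 ω ^ 2 ∂μ) • Γ⁻¹)) := by
  have hVm0 : ∀ k i, Measurable fun ω => V k ω i := fun k i => (hVm k i).mono (F.le k) le_rfl
  have hs : 0 ≤ ∫ ω, η 0 ω ^ 2 ∂μ := integral_nonneg fun _ => sq_nonneg _
  have hmeas : ∀ n : ℕ, Measurable fun ω => (WithLp.toLp 2 (Γ⁻¹.mulVec
        (√(n : ℝ) • avgScore (fun k => V k ω) (fun k => η k ω) 0 n)) : EuclideanSpace ℝ ι) := by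
    intro n
    have h1 : Measurable fun ω => √(n : ℝ) • avgScore (fun k => V k ω) (fun k => η k ω) 0 n := by
      refine measurable_pi_lambda _ fun i => ?_
      simp only [Pi.smul_apply, avgScore_zero_apply, smul_eq_mul]
      exact ((Finset.measurable_fun_sum _ fun k _ =>
        (hVm0 k i).mul (h.measurable' k)).const_mul _).const_mul _
    have h2 : Measurable fun x : ι → ℝ => (WithLp.toLp 2 (Γ⁻¹.mulVec x) : EuclideanSpace ℝ ι) := by
      have : Continuous fun x : ι → ℝ => Γ⁻¹.mulVec x :=
        (Matrix.mulVecLin Γ⁻¹).continuous_of_finiteDimensional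
      exact ((PiLp.continuous_toLp 2 _).comp this).measurable
    exact h2.comp h1
  refine ⟨fun n => (hmeas n).aemeasurable, aemeasurable_id, ?_⟩
  refine ProbabilityMeasure.tendsto_of_tendsto_charFun fun t => ?_
  simp only [ProbabilityMeasure.coe_mk, Measure.map_id]
  -- By symmetry Γ⁻¹ moves onto the test vector, and the limiting variance wᵀΓw becomes tᵀΓ⁻¹t.
  set w : ι → ℝ := Γ⁻¹.mulVec t with hw
  have hdet : IsUnit Γ.det := (Matrix.isUnit_iff_isUnit_det _).1 hΓ.isUnit
  have hsymm : Γ⁻¹.transpose = Γ⁻¹ := by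
    have := hΓ.inv.isHermitian
    simpa [Matrix.IsHermitian, Matrix.conjTranspose_eq_transpose_of_trivial] using this
  have hv : w ⬝ᵥ Γ.mulVec w = (t : ι → ℝ) ⬝ᵥ Γ⁻¹.mulVec t := by
    rw [hw, Matrix.mulVec_mulVec, Matrix.mul_nonsing_inv _ hdet, Matrix.one_mulVec,
      dotProduct_comm]
  have hv0 : 0 ≤ w ⬝ᵥ Γ.mulVec w := by
    have := hΓ.posSemidef.dotProduct_mulVec_nonneg w
    simpa using this
  have ham : ∀ k, Measurable[F k] fun ω => ∑ i, w i * V k ω i := fun k =>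
    Finset.measurable_fun_sum _ fun i _ => (hVm k i).const_mul _
  have haC : ∀ k ω, |∑ i, w i * V k ω i| ≤ Fintype.card ι * (‖w‖ * C) := fun k ω =>
    abs_sum_mul_le (V := fun k => V k ω) (fun k => hVC k ω) (fun i => norm_le_pi_norm w i) k
  have hclt := h.tendsto_integral_cexp ham haC hv0
    (tendsto_integral_abs_avg_linear_sq hVm0 hVC hlln w)
  have hpsd : ((∫ ω, η 0 ω ^ 2 ∂μ) • Γ⁻¹).PosSemidef := hΓ.inv.posSemidef.smul hs
  rw [charFun_multivariateGaussian hpsd]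
  convert hclt using 2 with n
  · rw [charFun_apply, integral_map (hmeas n).aemeasurable (by fun_prop)]
    refine integral_congr_ae (Eventually.of_forall fun ω => ?_)
    simp only
    congr 3
    rw [PiLp.inner_apply]
    simp only [RCLike.inner_apply, conj_trivial]
    have h1 : ∑ i, t i * Γ⁻¹.mulVec (√(n : ℝ) •
        avgScore (fun k => V k ω) (fun k => η k ω) 0 n) i
        = w ⬝ᵥ (√(n : ℝ) • avgScore (fun k => V k ω) (fun k => η k ω) 0 n) := by
      rw [hw]
      change (t : ι → ℝ) ⬝ᵥ Γ⁻¹.mulVec _ = _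
      rw [Matrix.dotProduct_mulVec, ← Matrix.mulVec_transpose, hsymm]
    rw [h1]
    simp only [dotProduct, Pi.smul_apply, avgScore_zero_apply, smul_eq_mul]
    have h2 : ∀ x : ℝ, √(n : ℝ) * ((n : ℝ)⁻¹ * x) = (√n)⁻¹ * x := by
      intro x
      rcases Nat.eq_zero_or_pos n with rfl | hn
      · simp
      · have : (0 : ℝ) < √n := Real.sqrt_pos.2 (by exact_mod_cast hn)
        have hsq : (n : ℝ) = √n * √n := (Real.mul_self_sqrt (by positivity)).symm
        rw [← mul_assoc]
        congr 1
        conv_lhs => rw [hsq, Real.sqrt_mul_self this.le]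
        field_simp
    simp only [h2, Finset.mul_sum, Finset.sum_mul]
    rw [Finset.sum_comm]
    exact Finset.sum_congr rfl fun k _ => Finset.sum_congr rfl fun i _ => by ring
  · rw [hv]
    simp [Matrix.smul_mulVec, dotProduct_smul, mul_div_assoc]

open scoped Matrix.Norms.Operator in
/-- Asymptotic normality of a one-step estimator whose standardised error solves a linear system
given by the weighted averages, with weights depending on a `√n`-consistent preliminary value. -/
theorem tendstoInDistribution_of_linear_system (h : IsInnovation μ F η)
    (hVm : ∀ k i, Measurable[F k] fun ω => V k ω i) (hVC : ∀ k ω i, |V k ω i| ≤ C)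
    {Γ : Matrix ι ι ℝ} (hΓ : Γ.PosDef)
    (hlln : ∀ i j, Tendsto (fun n : ℕ =>
      ∫ ω, |(n : ℝ)⁻¹ * ∑ k ∈ Finset.range n, V k ω i * V k ω j - Γ i j| ∂μ) atTop (𝓝 0))
    {d : ℕ → Ω → ι → ℝ} {D : ℕ → Ω → ℝ} (hd : ∀ n ω i, |d n ω i| ≤ D n ω)
    (hD : IsBoundedInProbability μ fun (n : ℕ) ω => √(n : ℝ) * D n ω)
    {T : ℕ → Ω → EuclideanSpace ℝ ι} (hTm : ∀ n, AEMeasurable (T n) μ)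
    (hT : ∀ n, 0 < n → ∀ ω, IsUnit (avgGram (fun k => V k ω) (d n ω) n).det →
      T n ω = WithLp.toLp 2 ((avgGram (fun k => V k ω) (d n ω) n)⁻¹.mulVec
        (√(n : ℝ) • avgScore (fun k => V k ω) (fun k => η k ω) (d n ω) n))) :
    TendstoInDistribution T atTop (id : EuclideanSpace ℝ ι → EuclideanSpace ℝ ι) (fun _ => μ)
      (multivariateGaussian 0 ((∫ ω, η 0 ω ^ 2 ∂μ) • Γ⁻¹)) := by
  have hVm0 : ∀ k i, Measurable fun ω => V k ω i := fun k i => (hVm k i).mono (F.le k) le_rfl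
  have hdet : IsUnit Γ.det := (Matrix.isUnit_iff_isUnit_det _).1 hΓ.isUnit
  set m : ℝ := (Fintype.card ι : ℝ) with hm
  have hm0 : 0 ≤ m := Nat.cast_nonneg _
  have hsqrt0 : Tendsto (fun n : ℕ => (√(n : ℝ))⁻¹) atTop (𝓝 0) :=
    tendsto_inv_atTop_zero.comp (Real.tendsto_sqrt_atTop.comp tendsto_natCast_atTop_atTop)
  have hsq0 : TendstoInMeasure μ (fun (n : ℕ) (_ : Ω) => (√(n : ℝ))⁻¹) atTop (fun _ => 0) :=
    tendstoInMeasure_zero_of_tendsto hsqrt0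
  have hsqrtne : ∀ n : ℕ, 0 < n → √(n : ℝ) ≠ 0 := fun n hn =>
    (Real.sqrt_pos.2 (by exact_mod_cast hn)).ne'
  -- the preliminary error is small
  have hDsmall : TendstoInMeasure μ (fun (n : ℕ) ω => √(n : ℝ) * D n ω * (√(n : ℝ))⁻¹) atTop
      (fun _ => 0) := hD.mul_tendstoInMeasure_zero hsq0
  have hGramInt : ∀ (n : ℕ) i j, Integrable
      (fun ω => (n : ℝ)⁻¹ * ∑ k ∈ Finset.range n, V k ω i * V k ω j - Γ i j) μ := by
    intro n i j
    refine Integrable.sub (Integrable.const_mul (integrable_finsetSum _ fun k _ => ?_) _)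
      (integrable_const _)
    refine Integrable.of_bound ((hVm0 k i).mul (hVm0 k j)).aestronglyMeasurable (C * C)
      (Eventually.of_forall fun ω => ?_)
    rw [Real.norm_eq_abs, abs_mul]
    exact mul_le_mul (hVC k ω i) (hVC k ω j) (abs_nonneg _) ((abs_nonneg _).trans (hVC k ω i))
  have hGram : ∀ i j, TendstoInMeasure μ (fun (n : ℕ) ω =>
      |(n : ℝ)⁻¹ * ∑ k ∈ Finset.range n, V k ω i * V k ω j - Γ i j|) atTop (fun _ => 0) :=
    fun i j => TendstoInMeasure.abs_zero
      (tendstoInMeasure_of_tendsto_integral_abs (fun n => hGramInt n i j) (hlln i j))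
  -- weighted averages of innovations
  have hVVm : ∀ i j k, Measurable[F k] fun ω => V k ω i * V k ω j := fun i j k =>
    (hVm k i).mul (hVm k j)
  have hVVC : ∀ i j k ω, |V k ω i * V k ω j| ≤ C * C := fun i j k ω => by
    rw [abs_mul]
    exact mul_le_mul (hVC k ω i) (hVC k ω j) (abs_nonneg _) ((abs_nonneg _).trans (hVC k ω i))
  have hB : ∀ i j, TendstoInMeasure μ (fun (n : ℕ) ω =>
      |(n : ℝ)⁻¹ * ∑ k ∈ Finset.range n, V k ω i * V k ω j * η k ω|) atTop (fun _ => 0) := by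
    intro i j
    refine TendstoInMeasure.abs_zero (tendstoInMeasure_of_tendsto_integral_abs
      (fun n => (h.integrable_sum (hVVm i j) (hVVC i j) n).const_mul _) ?_)
    have hlim := hsqrt0.mul_const (√((C * C) ^ 2 * ∫ ω, η 0 ω ^ 2 ∂μ))
    rw [zero_mul] at hlim
    refine squeeze_zero' (Eventually.of_forall fun n => integral_nonneg fun _ => abs_nonneg _)
      ?_ hlim
    filter_upwards [eventually_gt_atTop 0] with n hn
    have hle := h.integral_abs_sum_le (hVVm i j) (hVVC i j) n
    simp only [abs_mul, abs_inv, Nat.abs_cast]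
    rw [integral_const_mul]
    have hn0 := hsqrtne n hn
    have hsqn : (n : ℝ) = √n * √n := (Real.mul_self_sqrt (by positivity)).symm
    calc (n : ℝ)⁻¹ * ∫ ω, |∑ k ∈ Finset.range n, V k ω i * V k ω j * η k ω| ∂μ
        ≤ (n : ℝ)⁻¹ * (√n * √((C * C) ^ 2 * ∫ ω, η 0 ω ^ 2 ∂μ)) :=
          mul_le_mul_of_nonneg_left hle (by positivity)
      _ = (√n)⁻¹ * √((C * C) ^ 2 * ∫ ω, η 0 ω ^ 2 ∂μ) := by
          rw [← mul_assoc]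
          congr 1
          conv_lhs => rw [hsqn, Real.sqrt_mul_self (Real.sqrt_nonneg _)]
          field_simp
  have hAbs : IsBoundedInProbability μ (fun (n : ℕ) ω =>
      (n : ℝ)⁻¹ * ∑ k ∈ Finset.range n, |η k ω|) := by
    have hηint : ∀ k, Integrable (fun ω => |η k ω|) μ := fun k =>
      ((h.memLp_two k).integrable (by norm_num)).abs
    refine isBoundedInProbability_of_integral_abs_le (K := ∫ ω, |η 0 ω| ∂μ)
      (fun n => (integrable_finsetSum _ fun k _ => hηint k).const_mul _) ?_
    filter_upwards [eventually_gt_atTop 0] with n hn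
    have hn' : (n : ℝ) ≠ 0 := by positivity
    have habs : ∀ ω, |(n : ℝ)⁻¹ * ∑ k ∈ Finset.range n, (|η k ω|)|
        = (n : ℝ)⁻¹ * ∑ k ∈ Finset.range n, |η k ω| := fun ω =>
      abs_of_nonneg (mul_nonneg (by positivity) (Finset.sum_nonneg fun _ _ => abs_nonneg _))
    simp only [habs]
    rw [integral_const_mul, integral_finsetSum _ fun k _ => hηint k]
    have hk : ∀ k, ∫ ω, |η k ω| ∂μ = ∫ ω, |η 0 ω| ∂μ := fun k =>
      ((h.ident k).comp measurable_abs).integral_eq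
    simp only [hk, Finset.sum_const, Finset.card_range, nsmul_eq_mul]
    rw [← mul_assoc, inv_mul_cancel₀ hn', one_mul]
  -- the leading term is bounded in probability
  set v₀ : ℕ → Ω → ι → ℝ := fun n ω =>
    Γ⁻¹.mulVec (√(n : ℝ) • avgScore (fun k => V k ω) (fun k => η k ω) 0 n) with hv₀
  have hscore : ∀ i, IsBoundedInProbability μ (fun (n : ℕ) ω =>
      (√(n : ℝ) • avgScore (fun k => V k ω) (fun k => η k ω) 0 n) i) := by
    intro i
    have hint : ∀ n : ℕ, Integrable (fun ω => ∑ k ∈ Finset.range n, V k ω i * η k ω) μ := fun n =>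
      h.integrable_sum (fun k => hVm k i) (fun k ω => hVC k ω i) n
    simp only [Pi.smul_apply, avgScore_zero_apply, smul_eq_mul]
    refine isBoundedInProbability_of_integral_abs_le (K := √(C ^ 2 * ∫ ω, η 0 ω ^ 2 ∂μ))
      (fun n => ((hint n).const_mul _).const_mul _) ?_
    filter_upwards [eventually_gt_atTop 0] with n hn
    have hle := h.integral_abs_sum_le (fun k => hVm k i) (fun k ω => hVC k ω i) n
    have hn0 := hsqrtne n hn
    have hsqn : (n : ℝ) = √n * √n := (Real.mul_self_sqrt (by positivity)).symm
    have hfac : √(n : ℝ) * (n : ℝ)⁻¹ = (√n)⁻¹ := by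
      conv_lhs => rw [hsqn, Real.sqrt_mul_self (Real.sqrt_nonneg _)]
      field_simp
    simp only [← mul_assoc, hfac, abs_mul, abs_inv, abs_of_nonneg (Real.sqrt_nonneg (n : ℝ))]
    rw [integral_const_mul, inv_mul_le_iff₀ (Real.sqrt_pos.2 (by exact_mod_cast hn))]
    exact hle
  -- composite remainders
  set δ : ℕ → Ω → ℝ := fun n ω => ‖Γ⁻¹‖ * ∑ i, ∑ j,
    (|(n : ℝ)⁻¹ * ∑ k ∈ Finset.range n, V k ω i * V k ω j - Γ i j|
      + C ^ 2 * (10 * m * C) * (√(n : ℝ) * D n ω * (√(n : ℝ))⁻¹)) with hδ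
  have hδsmall : TendstoInMeasure μ δ atTop (fun _ => 0) :=
    TendstoInMeasure.const_mul_zero (TendstoInMeasure.finset_sum_zero fun i _ =>
      TendstoInMeasure.finset_sum_zero fun j _ =>
        TendstoInMeasure.add_zero (hGram i j) (TendstoInMeasure.const_mul_zero hDsmall _)) _
  -- This is √n times the score bound, with √n D² rewritten as (√n D)² / √n so that each factor is
  -- visibly O_p(1) or o_p(1).
  set r : ℕ → Ω → ℝ := fun n ω => ∑ i, (2 * (√(n : ℝ) * D n ω *
        ∑ j, |(n : ℝ)⁻¹ * ∑ k ∈ Finset.range n, V k ω i * V k ω j * η k ω|)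
      + C * 16 * (m * C) ^ 2 * ((√(n : ℝ) * D n ω) * ((√(n : ℝ) * D n ω) *
        (((n : ℝ)⁻¹ * ∑ k ∈ Finset.range n, |η k ω|) * (√(n : ℝ))⁻¹)))) with hr
  have hrsmall : TendstoInMeasure μ r atTop (fun _ => 0) :=
    TendstoInMeasure.finset_sum_zero fun i _ => TendstoInMeasure.add_zero
      (TendstoInMeasure.const_mul_zero (hD.mul_tendstoInMeasure_zero
        (TendstoInMeasure.finset_sum_zero fun j _ => hB i j)) _)
      (TendstoInMeasure.const_mul_zero (hD.mul_tendstoInMeasure_zero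
        (hD.mul_tendstoInMeasure_zero (hAbs.mul_tendstoInMeasure_zero hsq0))) _)
  have hlead : TendstoInMeasure μ (fun (n : ℕ) ω => ∑ i,
      |(√(n : ℝ) • avgScore (fun k => V k ω) (fun k => η k ω) 0 n) i * δ n ω|) atTop
      (fun _ => 0) :=
    TendstoInMeasure.finset_sum_zero fun i _ =>
      TendstoInMeasure.abs_zero ((hscore i).mul_tendstoInMeasure_zero hδsmall)
  have hdiff : TendstoInMeasure μ (fun n ω => T n ω - WithLp.toLp 2 (v₀ n ω)) atTop
      (fun _ => 0) := by
    -- The event A ≤ 1/2 secures both δ ≤ 1/2 for the perturbation bound and |dᵀV| ≤ 1/2 for the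
    -- Taylor bounds.
    refine TendstoInMeasure.of_eventually_norm_le
      (A := fun (n : ℕ) ω => δ n ω + m * C * (√(n : ℝ) * D n ω * (√(n : ℝ))⁻¹))
      (R := fun (n : ℕ) ω => m * (2 * ‖Γ⁻¹‖ * r n ω + 2 * ‖Γ⁻¹‖ * ∑ i,
        |(√(n : ℝ) • avgScore (fun k => V k ω) (fun k => η k ω) 0 n) i * δ n ω|))
      (TendstoInMeasure.add_zero hδsmall (TendstoInMeasure.const_mul_zero hDsmall _))
      (TendstoInMeasure.const_mul_zero (TendstoInMeasure.add_zero
        (TendstoInMeasure.const_mul_zero hrsmall _)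
        (TendstoInMeasure.const_mul_zero hlead _)) _) (c := 1 / 2) (by norm_num) ?_
    filter_upwards [eventually_gt_atTop 0] with n hn ω hA
    -- The signs of C and D are read off from a coordinate, so an empty index type is treated apart.
    rcases isEmpty_or_nonempty ι with hι | ⟨⟨i₀⟩⟩
    · have h0 : T n ω - WithLp.toLp 2 (v₀ n ω) = 0 := by ext i; exact hι.elim i
      rw [h0, norm_zero]
      simp [hm]
    have hC : 0 ≤ C := (abs_nonneg _).trans (hVC 0 ω i₀)
    have hD0 : 0 ≤ D n ω := (abs_nonneg _).trans (hd n ω i₀)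
    have hn0 := hsqrtne n hn
    have hcancel : √(n : ℝ) * D n ω * (√(n : ℝ))⁻¹ = D n ω := by field_simp
    rw [hcancel] at hA
    have hδ0 : 0 ≤ δ n ω := by
      simp only [hδ, hcancel]
      positivity
    have hsmall : Fintype.card ι * (D n ω * C) ≤ 1 / 2 := by
      rw [← hm]; nlinarith
    have hδ2 : δ n ω ≤ 1 / 2 := by
      have : 0 ≤ m * C * D n ω := by positivity
      linarith
    set M := avgGram (fun k => V k ω) (d n ω) n with hM
    have hMδ : ‖Γ⁻¹‖ * ‖M - Γ‖ ≤ δ n ω := by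
      refine mul_le_mul_of_nonneg_left ((linfty_opNorm_le_sum _).trans ?_) (norm_nonneg _)
      refine Finset.sum_le_sum fun i _ => Finset.sum_le_sum fun j _ => ?_
      have h1 := abs_avgGram_sub_le (V := fun k => V k ω) (fun k i => hVC k ω i) (hd n ω)
        hsmall hn i j
      rw [avgGram_zero_apply] at h1
      have h2 := abs_sub_le (M i j) ((n : ℝ)⁻¹ * ∑ k ∈ Finset.range n, V k ω i * V k ω j) (Γ i j)
      rw [Matrix.sub_apply, hcancel]
      have h3 : C ^ 2 * (10 * (Fintype.card ι * (D n ω * C))) = C ^ 2 * (10 * m * C) * D n ω := by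
        rw [hm]; ring
      linarith
    obtain ⟨hunit, hbound⟩ := norm_inv_mulVec_sub_le hdet hMδ hδ2
      (√(n : ℝ) • avgScore (fun k => V k ω) (fun k => η k ω) (d n ω) n)
      (√(n : ℝ) • avgScore (fun k => V k ω) (fun k => η k ω) 0 n)
    rw [hT n hn ω hunit, ← WithLp.toLp_sub]
    have hgd : ‖√(n : ℝ) • avgScore (fun k => V k ω) (fun k => η k ω) (d n ω) n
        - √(n : ℝ) • avgScore (fun k => V k ω) (fun k => η k ω) 0 n‖ ≤ r n ω := by
      refine (pi_norm_le_sum _).trans (Finset.sum_le_sum fun i _ => ?_)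
      have h1 := abs_avgScore_sub_le (V := fun k => V k ω) (η := fun k => η k ω)
        (fun k i => hVC k ω i) (hd n ω) hsmall n i
      rw [Pi.sub_apply, Pi.smul_apply, Pi.smul_apply, smul_eq_mul, smul_eq_mul, ← mul_sub,
        abs_mul, abs_of_nonneg (Real.sqrt_nonneg _)]
      refine (mul_le_mul_of_nonneg_left h1 (Real.sqrt_nonneg _)).trans (le_of_eq ?_)
      rw [← hm]
      field_simp
    have hv : ‖v₀ n ω‖ ≤ ‖Γ⁻¹‖ * ∑ i,
        |(√(n : ℝ) • avgScore (fun k => V k ω) (fun k => η k ω) 0 n) i| :=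
      (Matrix.linfty_opNorm_mulVec _ _).trans
        (mul_le_mul_of_nonneg_left (pi_norm_le_sum _) (norm_nonneg _))
    set x := M⁻¹.mulVec (√(n : ℝ) • avgScore (fun k => V k ω) (fun k => η k ω) (d n ω) n) - v₀ n ω
      with hx
    have hxnorm : ‖(WithLp.toLp 2 x : EuclideanSpace ℝ ι)‖ ≤ m * ‖x‖ := by
      have h1 : ‖(WithLp.toLp 2 x : EuclideanSpace ℝ ι)‖ ≤ ∑ i, |x i| := by
        rw [EuclideanSpace.norm_eq, Real.sqrt_le_left
          (Finset.sum_nonneg fun _ _ => abs_nonneg _)]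
        exact Finset.sum_sq_le_sq_sum_of_nonneg fun i _ => norm_nonneg _
      refine h1.trans ((Finset.sum_le_card_nsmul _ _ _ fun i _ => norm_le_pi_norm x i).trans ?_)
      simp [hm]
    refine hxnorm.trans (mul_le_mul_of_nonneg_left (hbound.trans ?_) hm0)
    have h1 : 2 * (‖Γ⁻¹‖ * ‖√(n : ℝ) • avgScore (fun k => V k ω) (fun k => η k ω) (d n ω) n
        - √(n : ℝ) • avgScore (fun k => V k ω) (fun k => η k ω) 0 n‖) ≤ 2 * ‖Γ⁻¹‖ * r n ω := by
      rw [mul_assoc]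
      gcongr
    refine add_le_add h1 ?_
    simp only [abs_mul, abs_of_nonneg hδ0]
    rw [← Finset.sum_mul]
    calc 2 * δ n ω * ‖v₀ n ω‖ ≤ 2 * δ n ω * (‖Γ⁻¹‖ * ∑ i,
        |(√(n : ℝ) • avgScore (fun k => V k ω) (fun k => η k ω) 0 n) i|) := by gcongr
      _ = _ := by ring
  refine tendstoInDistribution_of_tendstoInMeasure_sub T id
    (tendstoInDistribution_score h hVm hVC hΓ hlln) ?_ hTm
  exact hdiff

end AbstractScore

/-! ### Algebra of the estimator -/

section Regression

variable {Ω : Type*} {p : ℕ} (X : ℤ → Ω → ℝ)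

theorem sigmaSq_eq_sum (θ : EuclideanSpace ℝ (Fin (p + 1))) (t : ℤ) (ω : Ω) :
    sigmaSq X θ t ω = ∑ i, θ i * regressor p X (t - 1) ω i := by
  simp [sigmaSq, regressor, Fin.sum_univ_succ]

theorem regressor_nonneg (t : ℤ) (ω : Ω) (i : Fin (p + 1)) : 0 ≤ regressor p X t ω i := by
  refine Fin.cases ?_ (fun j => ?_) i
  · simp [regressor]
  · simpa [regressor] using sq_nonneg _

theorem sigmaSq_pos {θ : EuclideanSpace ℝ (Fin (p + 1))} (hθ : ∀ i, 0 < θ i) (t : ℤ) (ω : Ω) :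
    0 < sigmaSq X θ t ω :=
  add_pos_of_pos_of_nonneg (hθ 0)
    (Finset.sum_nonneg fun j _ => mul_nonneg (hθ j.succ).le (sq_nonneg _))

/-- The regressor divided by the true conditional variance, `Y_k / σ_{k+1}²(θ)`. -/
def scaledRegressor (θ : EuclideanSpace ℝ (Fin (p + 1))) (k : ℤ) (ω : Ω) : Fin (p + 1) → ℝ :=
  fun i => regressor p X k ω i / sigmaSq X θ (k + 1) ω

/-- The centred squared innovation `X_{k+1}² / σ_{k+1}²(θ) - 1`. -/
def squaredInnovation (θ : EuclideanSpace ℝ (Fin (p + 1))) (k : ℤ) (ω : Ω) : ℝ :=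
  X (k + 1) ω ^ 2 / sigmaSq X θ (k + 1) ω - 1

theorem sum_mul_scaledRegressor (θ θ₀ : EuclideanSpace ℝ (Fin (p + 1))) (k : ℤ) (ω : Ω) :
    ∑ i, θ i * scaledRegressor X θ₀ k ω i = sigmaSq X θ (k + 1) ω / sigmaSq X θ₀ (k + 1) ω := by
  rw [sigmaSq_eq_sum X θ, add_sub_cancel_right, Finset.sum_div]
  exact Finset.sum_congr rfl fun i _ => (mul_div_assoc _ _ _).symm

variable {X}

/-- The numbers θ_j V_j are nonnegative and sum to 1, so each V_i is at most 1/θ_i; the sum of the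
inverses is a bound independent of i. -/
theorem abs_scaledRegressor_le {θ : EuclideanSpace ℝ (Fin (p + 1))} (hθ : ∀ i, 0 < θ i) (k : ℤ)
    (ω : Ω) (i : Fin (p + 1)) : |scaledRegressor X θ k ω i| ≤ ∑ j, (θ j)⁻¹ := by
  have hnn : ∀ j, 0 ≤ scaledRegressor X θ k ω j := fun j =>
    div_nonneg (regressor_nonneg X k ω j) (sigmaSq_pos X hθ _ ω).le
  have hsum := sum_mul_scaledRegressor X θ θ k ω
  rw [div_self (sigmaSq_pos X hθ _ ω).ne'] at hsum
  have h1 : θ i * scaledRegressor X θ k ω i ≤ 1 := by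
    rw [← hsum]
    exact Finset.single_le_sum (f := fun j => θ j * scaledRegressor X θ k ω j)
      (fun j _ => mul_nonneg (hθ j).le (hnn j)) (Finset.mem_univ i)
  rw [abs_of_nonneg (hnn i)]
  have h2 : scaledRegressor X θ k ω i ≤ (θ i)⁻¹ := by
    rw [← one_div, le_div_iff₀ (hθ i), mul_comm]
    exact h1
  exact h2.trans (Finset.single_le_sum (f := fun j => (θ j)⁻¹)
    (fun j _ => (inv_pos.2 (hθ j)).le) (Finset.mem_univ i))

theorem ratio_eq {θ₀ : EuclideanSpace ℝ (Fin (p + 1))} (hθ₀ : ∀ i, 0 < θ₀ i)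
    (θ : EuclideanSpace ℝ (Fin (p + 1))) (k : ℤ) (ω : Ω) :
    1 + ∑ l, (θ l - θ₀ l) * scaledRegressor X θ₀ k ω l
      = sigmaSq X θ (k + 1) ω / sigmaSq X θ₀ (k + 1) ω := by
  simp only [sub_mul, Finset.sum_sub_distrib, sum_mul_scaledRegressor]
  rw [div_self (sigmaSq_pos X hθ₀ _ ω).ne']
  ring

theorem weightedGram_eq {θ₀ : EuclideanSpace ℝ (Fin (p + 1))} (hθ₀ : ∀ i, 0 < θ₀ i)
    (θ : EuclideanSpace ℝ (Fin (p + 1))) (k : ℤ) (ω : Ω) (i j : Fin (p + 1)) :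
    weightedGram X θ (k + 1) ω i j = scaledRegressor X θ₀ k ω i * scaledRegressor X θ₀ k ω j /
      (1 + ∑ l, (θ l - θ₀ l) * scaledRegressor X θ₀ k ω l) ^ 2 := by
  rw [ratio_eq hθ₀]
  have h0 := (sigmaSq_pos X hθ₀ (k + 1) ω).ne'
  simp only [weightedGram, scaledRegressor, Matrix.smul_apply, Matrix.vecMulVec_apply,
    add_sub_cancel_right, smul_eq_mul]
  -- A preliminary value may make the volatility vanish; division by zero then gives zero on both
  -- sides, so the identity needs no sign condition on θ.
  by_cases h : sigmaSq X θ (k + 1) ω = 0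
  · simp [h]
  · field_simp

/-- Comes from X² = σ²(θ₀)(1 + η) and θ₀ᵀV = 1. Summed over k, the second term is the Gram matrix
applied to θ₀, which cancels when θ₀ is subtracted from the estimator. -/
theorem weighted_response_eq {θ₀ : EuclideanSpace ℝ (Fin (p + 1))} (hθ₀ : ∀ i, 0 < θ₀ i)
    (θ : EuclideanSpace ℝ (Fin (p + 1))) (k : ℤ) (ω : Ω) (i : Fin (p + 1)) :
    X (k + 1) ω ^ 2 / sigmaSq X θ (k + 1) ω ^ 2 * regressor p X k ω i
      = scaledRegressor X θ₀ k ω i * squaredInnovation X θ₀ k ω /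
          (1 + ∑ l, (θ l - θ₀ l) * scaledRegressor X θ₀ k ω l) ^ 2
        + ∑ j, scaledRegressor X θ₀ k ω i * scaledRegressor X θ₀ k ω j /
          (1 + ∑ l, (θ l - θ₀ l) * scaledRegressor X θ₀ k ω l) ^ 2 * θ₀ j := by
  have h0 := (sigmaSq_pos X hθ₀ (k + 1) ω).ne'
  have h1 : ∑ j, scaledRegressor X θ₀ k ω i * scaledRegressor X θ₀ k ω j /
          (1 + ∑ l, (θ l - θ₀ l) * scaledRegressor X θ₀ k ω l) ^ 2 * θ₀ j
      = scaledRegressor X θ₀ k ω i /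
          (1 + ∑ l, (θ l - θ₀ l) * scaledRegressor X θ₀ k ω l) ^ 2
          * ∑ j, θ₀ j * scaledRegressor X θ₀ k ω j := by
    rw [Finset.mul_sum]
    exact Finset.sum_congr rfl fun j _ => by ring
  rw [h1, sum_mul_scaledRegressor, div_self h0, ratio_eq hθ₀]
  simp only [scaledRegressor, squaredInnovation]
  by_cases h : sigmaSq X θ (k + 1) ω = 0
  · simp [h]
  · field_simp
    ring

theorem sum_Icc_one_eq_sum_range {M : Type*} [AddCommMonoid M] (f : ℤ → M) (n : ℕ) :
    ∑ t ∈ Finset.Icc 1 n, f t = ∑ k ∈ Finset.range n, f ((k : ℤ) + 1) := by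
  have : Finset.Icc 1 n = Finset.Ico 1 (n + 1) := by ext; simp
  rw [this, Finset.sum_Ico_eq_sum_range]
  refine Finset.sum_congr (by simp) fun k _ => ?_
  congr 1
  push_cast
  ring

/-- The estimating-function estimator in terms of the weighted averages. -/
theorem efEstimator_sub_eq {θ₀ : EuclideanSpace ℝ (Fin (p + 1))} (hθ₀ : ∀ i, 0 < θ₀ i)
    (θ : EuclideanSpace ℝ (Fin (p + 1))) {n : ℕ} (hn : 0 < n) (ω : Ω)
    (hdet : IsUnit (avgGram (fun k : ℕ => scaledRegressor X θ₀ k ω) (fun l => θ l - θ₀ l) n).det) :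
    efEstimator X n θ ω - θ₀ = WithLp.toLp 2
      ((avgGram (fun k : ℕ => scaledRegressor X θ₀ k ω) (fun l => θ l - θ₀ l) n)⁻¹.mulVec
        (avgScore (fun k : ℕ => scaledRegressor X θ₀ k ω)
          (fun k : ℕ => squaredInnovation X θ₀ k ω) (fun l => θ l - θ₀ l) n)) := by
  set M := avgGram (fun k : ℕ => scaledRegressor X θ₀ k ω) (fun l => θ l - θ₀ l) n with hM
  set g := avgScore (fun k : ℕ => scaledRegressor X θ₀ k ω)
    (fun k : ℕ => squaredInnovation X θ₀ k ω) (fun l => θ l - θ₀ l) n with hg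
  have hn' : (n : ℝ) ≠ 0 := by positivity
  have hA : ∑ t ∈ Finset.Icc 1 n, weightedGram X θ (t : ℤ) ω = (n : ℝ) • M := by
    rw [sum_Icc_one_eq_sum_range (fun t => weightedGram X θ t ω)]
    ext i j
    simp only [Matrix.sum_apply, Matrix.smul_apply, smul_eq_mul, hM, avgGram, Matrix.of_apply,
      weightedGram_eq hθ₀]
    rw [mul_inv_cancel_left₀ hn']
  have hb : ∑ t ∈ Finset.Icc 1 n, (X (t : ℤ) ω ^ 2 / sigmaSq X θ (t : ℤ) ω ^ 2) •
      regressor p X ((t : ℤ) - 1) ω = ((n : ℝ) • M).mulVec (M⁻¹.mulVec g + θ₀) := by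
    rw [sum_Icc_one_eq_sum_range
      (fun t => (X t ω ^ 2 / sigmaSq X θ t ω ^ 2) • regressor p X (t - 1) ω)]
    have h1 : ((n : ℝ) • M).mulVec (M⁻¹.mulVec g + θ₀) = (n : ℝ) • (g + M.mulVec θ₀) := by
      rw [Matrix.smul_mulVec, Matrix.mulVec_add, Matrix.mulVec_mulVec,
        Matrix.mul_nonsing_inv _ hdet, Matrix.one_mulVec]
    rw [h1]
    ext i
    simp only [Finset.sum_apply, Pi.smul_apply, Pi.add_apply, smul_eq_mul, add_sub_cancel_right,
      weighted_response_eq hθ₀, Finset.sum_add_distrib]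
    rw [mul_add, hg, avgScore, mul_inv_cancel_left₀ hn']
    congr 1
    rw [Finset.sum_comm]
    simp only [Matrix.mulVec, dotProduct, hM, avgGram, Matrix.of_apply]
    rw [Finset.mul_sum]
    refine Finset.sum_congr rfl fun j _ => ?_
    rw [← mul_assoc, mul_inv_cancel_left₀ hn', Finset.sum_mul]
  have hAdet : IsUnit ((n : ℝ) • M).det := by
    rw [Matrix.det_smul]
    exact ((isUnit_iff_ne_zero.2 hn').pow _).mul hdet
  rw [efEstimator, hA, hb, Matrix.mulVec_mulVec, Matrix.nonsing_inv_mul _ hAdet, Matrix.one_mulVec]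
  ext i
  simp

theorem shift_iterate_apply (k : ℕ) (x : ℤ → ℝ) (t : ℤ) : shift^[k] x t = x (t + k) := by
  induction k generalizing x with
  | zero => simp
  | succ k ih =>
    rw [Function.iterate_succ_apply, ih, shift]
    push_cast
    congr 1
    ring

/-- Exhibits the regressors as one observable along the orbit of the shift, the form required by the
ergodic theorem. -/
theorem scaledRegressor_eq_shift (θ : EuclideanSpace ℝ (Fin (p + 1))) (k : ℕ) (ω : Ω) :
    scaledRegressor X θ (k : ℤ) ω
      = scaledRegressor (fun t (x : ℤ → ℝ) => x t) θ 0 (shift^[k] fun t => X t ω) := by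
  have hY : ∀ i, regressor p X (k : ℤ) ω i
      = regressor p (fun t (x : ℤ → ℝ) => x t) 0 (shift^[k] fun t => X t ω) i := by
    intro i
    refine Fin.cases ?_ (fun j => ?_) i
    · simp [regressor]
    · simp only [regressor, Fin.cons_succ, shift_iterate_apply]
      ring_nf
  funext i
  simp only [scaledRegressor, sigmaSq_eq_sum, add_sub_cancel_right, hY]

end Regression

/-! ### Measurability -/

section Measurability

variable {Ω : Type*} {p : ℕ} {X : ℤ → Ω → ℝ}

/-- The inverse is the adjugate times the inverse of the determinant. The convention 0⁻¹ = 0 covers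
singular matrices, so the formula is measurable everywhere. -/
theorem measurable_matrix_inv_apply {α ι : Type*} [MeasurableSpace α] [Fintype ι] [DecidableEq ι]
    {A : α → Matrix ι ι ℝ} (hA : ∀ i j, Measurable fun a => A a i j) (i j : ι) :
    Measurable fun a => (A a)⁻¹ i j := by
  have hf : Measurable fun a => fun i j => A a i j :=
    measurable_pi_lambda _ fun i => measurable_pi_lambda _ fun j => hA i j
  have hdet : Continuous fun B : ι → ι → ℝ => (Matrix.of B).det :=
    Continuous.matrix_det (continuous_matrix fun i j => by simpa using by fun_prop)
  have hadj : Continuous fun B : ι → ι → ℝ => (Matrix.of B).adjugate i j :=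
    (Continuous.matrix_adjugate (continuous_matrix fun i j => by simpa using by fun_prop)).matrix_elem
      i j
  have := ((hdet.measurable.comp hf).inv).mul (hadj.measurable.comp hf)
  simp only [Matrix.inv_def, Ring.inverse_eq_inv', Matrix.smul_apply, smul_eq_mul]
  exact this

theorem measurable_regressor_apply [mΩ : MeasurableSpace Ω] {t : ℤ} (hX : ∀ s ≤ t, Measurable (X s))
    (i : Fin (p + 1)) : Measurable fun ω => regressor p X t ω i := by
  refine Fin.cases ?_ (fun j => ?_) i
  · simp [regressor]
  · simpa [regressor] using (hX (t - j) (by omega)).pow_const 2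

theorem measurable_sigmaSq_uncurry [mΩ : MeasurableSpace Ω] {t : ℤ}
    (hX : ∀ s < t, Measurable (X s)) :
    Measurable fun z : EuclideanSpace ℝ (Fin (p + 1)) × Ω => sigmaSq X z.1 t z.2 := by
  have hθ : ∀ i, Measurable fun z : EuclideanSpace ℝ (Fin (p + 1)) × Ω => z.1 i := fun i => by
    fun_prop
  exact (hθ 0).add (Finset.measurable_fun_sum _ fun j _ =>
    (hθ j.succ).mul (((hX _ (by omega)).comp measurable_snd).pow_const 2))

theorem measurable_sigmaSq [mΩ : MeasurableSpace Ω] {t : ℤ} (hX : ∀ s < t, Measurable (X s))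
    (θ : EuclideanSpace ℝ (Fin (p + 1))) : Measurable (sigmaSq X θ t) :=
  (measurable_sigmaSq_uncurry hX).comp (measurable_const.prodMk measurable_id)

theorem measurable_scaledRegressor_apply [mΩ : MeasurableSpace Ω] {t : ℤ}
    (hX : ∀ s ≤ t, Measurable (X s)) (θ : EuclideanSpace ℝ (Fin (p + 1))) (i : Fin (p + 1)) :
    Measurable fun ω => scaledRegressor X θ t ω i :=
  (measurable_regressor_apply hX i).div (measurable_sigmaSq (fun s hs => hX s (by omega)) θ)

theorem measurable_squaredInnovation [mΩ : MeasurableSpace Ω] {t : ℤ}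
    (hX : ∀ s ≤ t + 1, Measurable (X s)) (θ : EuclideanSpace ℝ (Fin (p + 1))) :
    Measurable (squaredInnovation X θ t) :=
  (((hX _ le_rfl).pow_const 2).div (measurable_sigmaSq (fun s hs => hX s hs.le) θ)).sub_const 1

/-- Joint measurability in (θ, ω) is needed because a random preliminary value is substituted for θ.
-/
theorem measurable_efEstimator_uncurry [mΩ : MeasurableSpace Ω] (hX : ∀ s, Measurable (X s)) (n : ℕ) :
    Measurable fun z : EuclideanSpace ℝ (Fin (p + 1)) × Ω => efEstimator X n z.1 z.2 := by
  have hY : ∀ (t : ℤ) i, Measurable fun z : EuclideanSpace ℝ (Fin (p + 1)) × Ω =>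
      regressor p X t z.2 i := fun t i =>
    (measurable_regressor_apply (fun s _ => hX s) i).comp measurable_snd
  have hσ : ∀ t : ℤ, Measurable fun z : EuclideanSpace ℝ (Fin (p + 1)) × Ω =>
      sigmaSq X z.1 t z.2 ^ 2 := fun t =>
    (measurable_sigmaSq_uncurry fun s _ => hX s).pow_const 2
  have hinv : ∀ i j, Measurable fun z : EuclideanSpace ℝ (Fin (p + 1)) × Ω =>
      (∑ t ∈ Finset.Icc 1 n, weightedGram X z.1 (t : ℤ) z.2)⁻¹ i j := by
    refine measurable_matrix_inv_apply fun i j => ?_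
    simp only [Matrix.sum_apply, weightedGram, Matrix.smul_apply, Matrix.vecMulVec_apply,
      smul_eq_mul]
    exact Finset.measurable_fun_sum _ fun t _ => (hσ t).inv.mul ((hY _ i).mul (hY _ j))
  refine (PiLp.continuous_toLp 2 _).measurable.comp (measurable_pi_lambda _ fun i => ?_)
  simp only [Matrix.mulVec, dotProduct, Finset.sum_apply, Pi.smul_apply, smul_eq_mul]
  exact Finset.measurable_fun_sum _ fun j _ => (hinv i j).mul (Finset.measurable_fun_sum _ fun t _ =>
    ((((hX t).comp measurable_snd).pow_const 2).div (hσ t)).mul (hY _ j))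

end Measurability

/-! ### The σ-algebras of the past -/

section Past

variable {Ω : Type*} {X : ℤ → Ω → ℝ}

/-- The σ-algebra generated by the process strictly before time `t`. -/
abbrev past (X : ℤ → Ω → ℝ) (t : ℤ) : MeasurableSpace Ω :=
  MeasurableSpace.comap (fun ω (s : Set.Iio t) => X s ω) inferInstance

theorem measurable_past {s t : ℤ} (hst : s < t) : Measurable[past X t] (X s) :=
  (measurable_pi_apply (⟨s, hst⟩ : Set.Iio t)).comp
    (comap_measurable fun ω (s : Set.Iio t) => X s ω)

theorem past_mono {s t : ℤ} (hst : s ≤ t) : past X s ≤ past X t :=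
  Measurable.comap_le (@measurable_pi_lambda _ _ _ (past X t) _ _ fun u =>
    measurable_past (lt_of_lt_of_le u.2 hst))

end Past

/-! ### Probabilistic consequences of the ARCH model -/

section Model

variable {Ω : Type*} [MeasurableSpace Ω] {μ : Measure Ω} {p : ℕ}
  {Θ : Set (EuclideanSpace ℝ (Fin (p + 1)))} {θ₀ : EuclideanSpace ℝ (Fin (p + 1))}
  {ε X : ℤ → Ω → ℝ}

/-- All coefficients are positive, since the parameter is an interior point. -/
theorem Regular.param_pos (h : Regular μ p Θ θ₀ ε X) (i : Fin (p + 1)) : 0 < θ₀ i := by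
  have hnn : ∀ θ ∈ Θ, 0 ≤ θ i := fun θ hθ => by
    refine Fin.cases ?_ (fun j => ?_) i
    · exact (h.subset_pos θ hθ).1.le
    · exact (h.subset_pos θ hθ).2 j
  -- Lowering coordinate i slightly keeps the point in Θ, where that coordinate is still
  -- nonnegative; so it was positive before.
  have hcont : Tendsto (fun s : ℝ => θ₀ - s • EuclideanSpace.single i (1 : ℝ)) (𝓝[>] 0)
      (𝓝 θ₀) := by
    have : Continuous fun s : ℝ => θ₀ - s • EuclideanSpace.single i (1 : ℝ) := by fun_prop
    have h2 := this.tendsto 0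
    simp only [zero_smul, sub_zero] at h2
    exact h2.mono_left nhdsWithin_le_nhds
  have hev := (hcont.eventually (mem_interior_iff_mem_nhds.1 h.mem_interior)).and
    self_mem_nhdsWithin
  obtain ⟨s, hs, hs0⟩ := hev.exists
  have := hnn _ hs
  simp only [PiLp.sub_apply, PiLp.smul_apply, PiLp.single_apply, if_true, smul_eq_mul,
    mul_one] at this
  have hs0' : 0 < s := hs0
  linarith

theorem past_le (hX : ∀ s, Measurable (X s)) (t : ℤ) : past X t ≤ ‹MeasurableSpace Ω› :=
  Measurable.comap_le (measurable_pi_lambda _ fun u => hX u)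

/-- The natural filtration, `F_k` being generated by `X_s`, `s ≤ k`. -/
def natFiltration (hX : ∀ s, Measurable (X s)) : Filtration ℕ ‹MeasurableSpace Ω› where
  seq k := past X ((k : ℤ) + 1)
  mono' _ _ hkl := past_mono (by omega)
  le' _ := past_le hX _

theorem IsARCH.squaredInnovation_ae_eq (hm : IsARCH μ p θ₀ ε X) (hθ₀ : ∀ i, 0 < θ₀ i) (k : ℤ) :
    squaredInnovation X θ₀ k =ᵐ[μ] fun ω => ε (k + 1) ω ^ 2 - 1 := by
  filter_upwards [hm.equation (k + 1)] with ω hω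
  have h0 := sigmaSq_pos X hθ₀ (k + 1) ω
  rw [squaredInnovation, hω, mul_pow, Real.sq_sqrt h0.le]
  field_simp

theorem IsARCH.memLp_sq (hm : IsARCH μ p θ₀ ε X)
    (h4 : Integrable (fun ω => ε 0 ω ^ 4) μ) : MemLp (fun ω => ε 0 ω ^ 2) 2 μ := by
  rw [memLp_two_iff_integrable_sq ((hm.measurable_innov 0).pow_const 2).aestronglyMeasurable]
  refine h4.congr (Eventually.of_forall fun ω => ?_)
  simp only
  ring

theorem IsARCH.integral_squaredInnovation_sq (hm : IsARCH μ p θ₀ ε X) (hθ₀ : ∀ i, 0 < θ₀ i) :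
    ∫ ω, squaredInnovation X θ₀ ((0 : ℕ) : ℤ) ω ^ 2 ∂μ = Var[fun ω => ε 0 ω ^ 2; μ] := by
  have h1 : IdentDistrib (fun ω => (ε 1 ω ^ 2 - 1) ^ 2) (fun ω => (ε 0 ω ^ 2 - 1) ^ 2) μ μ :=
    (hm.innov_identDistrib 1).comp (u := fun x : ℝ => (x ^ 2 - 1) ^ 2) (by fun_prop)
  rw [variance_eq_integral ((hm.measurable_innov 0).pow_const 2).aemeasurable,
    hm.innov_second_moment, ← h1.integral_eq]
  refine integral_congr_ae ?_
  filter_upwards [hm.squaredInnovation_ae_eq hθ₀ ((0 : ℕ) : ℤ)] with ω hω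
  rw [hω]
  simp

theorem Gam_apply_eq (hθ₀ : ∀ i, 0 < θ₀ i) (i j : Fin (p + 1)) :
    Gam μ X θ₀ i j = ∫ ω, scaledRegressor X θ₀ 0 ω i * scaledRegressor X θ₀ 0 ω j ∂μ := by
  rw [Gam, Matrix.of_apply]
  refine integral_congr_ae (Eventually.of_forall fun ω => ?_)
  have := weightedGram_eq (X := X) hθ₀ θ₀ 0 ω i j
  simpa using this

variable [IsProbabilityMeasure μ]

/-- The indices are offset by one: η_k involves X_{k+1}, so it is known at stage k + 1, while stage
k is generated by X_s with s < k + 1, exactly the family of which ε_{k+1} is independent. -/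
theorem IsARCH.isInnovation (hm : IsARCH μ p θ₀ ε X) (hθ₀ : ∀ i, 0 < θ₀ i)
    (h4 : Integrable (fun ω => ε 0 ω ^ 4) μ) :
    IsInnovation μ (natFiltration hm.measurable_proc)
      (fun k : ℕ => squaredInnovation X θ₀ (k : ℤ)) := by
  have hid : ∀ k : ℤ, IdentDistrib (squaredInnovation X θ₀ k) (fun ω => ε 0 ω ^ 2 - 1) μ μ := by
    intro k
    have h1 : IdentDistrib (fun ω => ε (k + 1) ω ^ 2 - 1) (fun ω => ε 0 ω ^ 2 - 1) μ μ :=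
      (hm.innov_identDistrib (k + 1)).comp (u := fun x : ℝ => x ^ 2 - 1) (by fun_prop)
    refine (IdentDistrib.of_ae_eq ?_ (hm.squaredInnovation_ae_eq hθ₀ k)).trans h1
    exact (measurable_squaredInnovation (fun s _ => hm.measurable_proc s) θ₀).aemeasurable
  refine ⟨fun k => ?_, fun k => ?_, fun k => (hid k).trans (hid (0 : ℕ)).symm, ?_, ?_⟩
  · refine measurable_squaredInnovation (mΩ := natFiltration hm.measurable_proc (k + 1))
      (fun s hs => ?_) θ₀
    exact measurable_past (by push_cast; omega)
  · have h1 : IndepFun (fun ω => ε ((k : ℤ) + 1) ω ^ 2 - 1)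
        (fun ω (s : Set.Iio ((k : ℤ) + 1)) => X s ω) μ :=
      (hm.innov_indep_past ((k : ℤ) + 1)).comp (φ := fun x : ℝ => x ^ 2 - 1) (by fun_prop)
        measurable_id
    have h2 := h1.congr (hm.squaredInnovation_ae_eq hθ₀ k).symm (ae_eq_refl _)
    exact (IndepFun_iff_Indep _ _ _).1 h2
  · exact (hid (0 : ℕ)).symm.memLp_snd ((hm.memLp_sq h4).sub (memLp_const 1))
  · rw [(hid (0 : ℕ)).integral_eq, integral_sub ((hm.memLp_sq h4).integrable (by norm_num))
      (integrable_const _), hm.innov_second_moment]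
    simp

/-- Law of large numbers for the normalised Gram matrix. -/
theorem IsARCH.tendsto_gram (hm : IsARCH μ p θ₀ ε X) (hθ₀ : ∀ i, 0 < θ₀ i) (i j : Fin (p + 1)) :
    Tendsto (fun n : ℕ => ∫ ω, |(n : ℝ)⁻¹ * ∑ k ∈ Finset.range n,
      scaledRegressor X θ₀ (k : ℤ) ω i * scaledRegressor X θ₀ (k : ℤ) ω j - Gam μ X θ₀ i j| ∂μ)
      atTop (𝓝 0) := by
  have hmap : Measurable fun ω => fun t => X t ω := measurable_pi_lambda _ hm.measurable_proc
  have : IsProbabilityMeasure (μ.map fun ω t => X t ω) :=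
    Measure.isProbabilityMeasure_map hmap.aemeasurable
  set G : (ℤ → ℝ) → ℝ := fun x => scaledRegressor (fun t (x : ℤ → ℝ) => x t) θ₀ 0 x i *
    scaledRegressor (fun t (x : ℤ → ℝ) => x t) θ₀ 0 x j with hG
  have hGm : Measurable G :=
    (measurable_scaledRegressor_apply (fun s _ => measurable_pi_apply s) θ₀ i).mul
      (measurable_scaledRegressor_apply (fun s _ => measurable_pi_apply s) θ₀ j)
  have hGL : MemLp G 2 (μ.map fun ω t => X t ω) := by
    refine MemLp.of_bound hGm.aestronglyMeasurable
      ((∑ j, (θ₀ j)⁻¹) * ∑ j, (θ₀ j)⁻¹) (Eventually.of_forall fun x => ?_)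
    rw [Real.norm_eq_abs, hG, abs_mul]
    exact mul_le_mul (abs_scaledRegressor_le hθ₀ _ _ _) (abs_scaledRegressor_le hθ₀ _ _ _)
      (abs_nonneg _) (Finset.sum_nonneg fun j _ => (inv_pos.2 (hθ₀ j)).le)
  have hGX : ∀ (k : ℕ) ω, G (shift^[k] fun t => X t ω)
      = scaledRegressor X θ₀ (k : ℤ) ω i * scaledRegressor X θ₀ (k : ℤ) ω j := by
    intro k ω
    simp only [hG, scaledRegressor_eq_shift (X := X)]
  have hlim := tendsto_integral_abs_ergodic_average hm.stationary_ergodic hGL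
  have hmean : ∫ y, G y ∂(μ.map fun ω t => X t ω) = Gam μ X θ₀ i j := by
    rw [integral_map hmap.aemeasurable hGm.aestronglyMeasurable, Gam_apply_eq hθ₀]
    refine integral_congr_ae (Eventually.of_forall fun ω => ?_)
    have := hGX 0 ω
    simpa using this
  rw [hmean] at hlim
  refine hlim.congr fun n => ?_
  have hshift : Measurable shift := measurable_pi_lambda _ fun t => measurable_pi_apply (t + 1)
  rw [integral_map hmap.aemeasurable]
  · simp only [hGX]
  · exact (((Finset.measurable_fun_sum _ fun k _ =>
      hGm.comp (hshift.iterate k)).const_mul _).sub_const _).abs.aestronglyMeasurable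

/-- The squared innovation is not a function of the past. -/
theorem IsARCH.not_ae_eq_past (hm : IsARCH μ p θ₀ ε X)
    (hnd : ¬ ∃ c : ℝ, ∀ᵐ ω ∂μ, ε 0 ω ^ 2 = c) (h4 : Integrable (fun ω => ε 0 ω ^ 4) μ)
    (t : ℤ) {q : Ω → ℝ} (hq : Measurable[past X t] q) :
    ¬ (fun ω => ε t ω ^ 2) =ᵐ[μ] q := by
  intro heq
  refine hnd ⟨_, ae_eq_integral_of_variance_eq_zero (hm.memLp_sq h4) ?_⟩
  have h1 : IndepFun (fun ω => ε t ω ^ 2) q μ := by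
    have h2 : IndepFun (fun ω => ε t ω ^ 2) (fun ω (s : Set.Iio t) => X s ω) μ :=
      (hm.innov_indep_past t).comp (φ := fun x : ℝ => x ^ 2) (by fun_prop) measurable_id
    rw [IndepFun_iff_Indep] at h2 ⊢
    exact indep_of_indep_of_le_right h2 hq.comap_le
  -- Being almost surely equal to a variable independent of it, ε_t² is independent of itself, so E
  -- ε⁴ = (E ε²)² and the variance is zero.
  have h3 : IndepFun (fun ω => ε t ω ^ 2) (fun ω => ε t ω ^ 2) μ :=
    h1.congr (ae_eq_refl _) heq.symm
  have hmeas := ((hm.measurable_innov t).pow_const 2).aestronglyMeasurable (μ := μ)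
  have h5 := h3.integral_fun_mul_eq_mul_integral hmeas hmeas
  have e2 : ∫ ω, ε t ω ^ 2 ∂μ = ∫ ω, ε 0 ω ^ 2 ∂μ :=
    ((hm.innov_identDistrib t).comp (u := fun x : ℝ => x ^ 2) (by fun_prop)).integral_eq
  have e4 : ∫ ω, ε t ω ^ 2 * ε t ω ^ 2 ∂μ = ∫ ω, ε 0 ω ^ 2 * ε 0 ω ^ 2 ∂μ :=
    ((hm.innov_identDistrib t).comp (u := fun x : ℝ => x ^ 2 * x ^ 2) (by fun_prop)).integral_eq
  rw [variance_eq_sub (hm.memLp_sq h4)]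
  simp only [Pi.pow_apply]
  rw [e2, e4] at h5
  have e6 : ∫ ω, (ε 0 ω ^ 2) ^ 2 ∂μ = ∫ ω, ε 0 ω ^ 2 * ε 0 ω ^ 2 ∂μ :=
    integral_congr_ae (Eventually.of_forall fun ω => by simp only; ring)
  rw [e6, h5]
  ring

/-- The regressor satisfies no nontrivial linear relation. -/
theorem IsARCH.eq_zero_of_ae_linear_relation (hm : IsARCH μ p θ₀ ε X) (hθ₀ : ∀ i, 0 < θ₀ i)
    (hnd : ¬ ∃ c : ℝ, ∀ᵐ ω ∂μ, ε 0 ω ^ 2 = c) (h4 : Integrable (fun ω => ε 0 ω ^ 4) μ)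
    {x : Fin (p + 1) → ℝ} (hx : ∀ᵐ ω ∂μ, ∑ i, x i * regressor p X 0 ω i = 0) : x = 0 := by
  have hx' : ∀ᵐ ω ∂μ, x 0 + ∑ l : Fin p, x l.succ * X (-(l : ℤ)) ω ^ 2 = 0 := by
    filter_upwards [hx] with ω hω
    simpa [regressor, Fin.sum_univ_succ] using hω
  have hsucc : ∀ (a : ℕ) (ha : a < p), x (Fin.succ ⟨a, ha⟩) = 0 := by
    intro a
    -- The coefficients are eliminated from the most recent lag backwards. Once the more recent ones
    -- vanish, a nonzero coefficient at lag a would express X_{-a}², and after division by σ² also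
    -- ε_{-a}², through strictly earlier values.
    induction a using Nat.strong_induction_on with
    | _ a ih =>
      intro ha
      by_contra hne
      set j : Fin p := ⟨a, ha⟩ with hj
      set R : Ω → ℝ := fun ω => x 0 + ∑ l : Fin p,
        if j < l then x l.succ * X (-(l : ℤ)) ω ^ 2 else 0 with hR
      have hRm : Measurable[past X (-(j : ℤ))] R := by
        refine Measurable.const_add (Finset.measurable_fun_sum _ fun l _ => ?_) _
        split_ifs with hl
        · refine ((measurable_past ?_).pow_const 2).const_mul _
          have : (j : ℕ) < l := hl
          omega
        · exact measurable_const
      have hσm : Measurable[past X (-(j : ℤ))] (sigmaSq X θ₀ (-(j : ℤ))) :=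
        measurable_sigmaSq (mΩ := past X (-(j : ℤ))) (fun s hs => measurable_past hs) θ₀
      have hqm : Measurable[past X (-(j : ℤ))] fun ω =>
          -R ω / x j.succ / sigmaSq X θ₀ (-(j : ℤ)) ω := (hRm.neg.div_const _).div hσm
      refine hm.not_ae_eq_past hnd h4 (-(j : ℤ)) hqm ?_
      filter_upwards [hx', hm.equation (-(j : ℤ))] with ω h1 h2
      have h0 := sigmaSq_pos X hθ₀ (-(j : ℤ)) ω
      have hsplit : ∑ l : Fin p, x l.succ * X (-(l : ℤ)) ω ^ 2
          = x j.succ * X (-(j : ℤ)) ω ^ 2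
            + ∑ l : Fin p, if j < l then x l.succ * X (-(l : ℤ)) ω ^ 2 else 0 := by
        have : ∀ l : Fin p, x l.succ * X (-(l : ℤ)) ω ^ 2
            = (if l = j then x l.succ * X (-(l : ℤ)) ω ^ 2 else 0)
              + if j < l then x l.succ * X (-(l : ℤ)) ω ^ 2 else 0 := by
          intro l
          rcases lt_trichotomy l j with hlt | rfl | hgt
          · have := ih (l : ℕ) hlt l.2
            simp only [Fin.eta] at this
            simp [this]
          · simp
          · simp [hgt, hgt.ne']
        conv_lhs => rw [Finset.sum_congr rfl fun l _ => this l]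
        rw [Finset.sum_add_distrib, Finset.sum_ite_eq']
        simp
      have h3 : -R ω = x j.succ * X (-(j : ℤ)) ω ^ 2 := by
        simp only [hR]
        linarith
      rw [h3, mul_div_cancel_left₀ _ hne, h2, mul_pow, Real.sq_sqrt h0.le,
        mul_div_cancel_left₀ _ h0.ne']
  have hzero : x 0 = 0 := by
    obtain ⟨ω, hω⟩ := hx'.exists
    rw [Finset.sum_eq_zero fun l _ => by
      have := hsucc l l.2
      simp only [Fin.eta] at this
      rw [this, zero_mul]] at hω
    simpa using hω
  funext i
  refine Fin.cases hzero (fun j => ?_) i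
  simpa using hsucc j j.2

/-- The quadratic form is xᵀΓx = E(xᵀV)², which vanishes only if xᵀY_0 = 0 almost surely. -/
theorem IsARCH.posDef_Gam (hm : IsARCH μ p θ₀ ε X) (hθ₀ : ∀ i, 0 < θ₀ i)
    (hnd : ¬ ∃ c : ℝ, ∀ᵐ ω ∂μ, ε 0 ω ^ 2 = c) (h4 : Integrable (fun ω => ε 0 ω ^ 4) μ) :
    (Gam μ X θ₀).PosDef := by
  have hVm : ∀ i, Measurable fun ω => scaledRegressor X θ₀ 0 ω i := fun i =>
    measurable_scaledRegressor_apply (fun s _ => hm.measurable_proc s) θ₀ i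
  have hint : ∀ i j, Integrable
      (fun ω => scaledRegressor X θ₀ 0 ω i * scaledRegressor X θ₀ 0 ω j) μ := by
    intro i j
    refine Integrable.of_bound ((hVm i).mul (hVm j)).aestronglyMeasurable
      ((∑ j, (θ₀ j)⁻¹) * ∑ j, (θ₀ j)⁻¹) (Eventually.of_forall fun ω => ?_)
    rw [Real.norm_eq_abs, abs_mul]
    exact mul_le_mul (abs_scaledRegressor_le hθ₀ _ _ _) (abs_scaledRegressor_le hθ₀ _ _ _)
      (abs_nonneg _) (Finset.sum_nonneg fun j _ => (inv_pos.2 (hθ₀ j)).le)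
  have hquad : ∀ x : Fin (p + 1) → ℝ, x ⬝ᵥ (Gam μ X θ₀).mulVec x
      = ∫ ω, (∑ i, x i * scaledRegressor X θ₀ 0 ω i) ^ 2 ∂μ := by
    intro x
    have h1 : ∀ ω, (∑ i, x i * scaledRegressor X θ₀ 0 ω i) ^ 2 = ∑ i, ∑ j,
        x i * x j * (scaledRegressor X θ₀ 0 ω i * scaledRegressor X θ₀ 0 ω j) := by
      intro ω
      rw [pow_two, Finset.sum_mul_sum]
      exact Finset.sum_congr rfl fun i _ => Finset.sum_congr rfl fun j _ => by ring
    simp only [h1]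
    rw [integral_finsetSum _ fun i _ => integrable_finsetSum _ fun j _ => (hint i j).const_mul _]
    simp only [dotProduct, Matrix.mulVec, Finset.mul_sum]
    refine Finset.sum_congr rfl fun i _ => ?_
    rw [integral_finsetSum _ fun j _ => (hint i j).const_mul _]
    refine Finset.sum_congr rfl fun j _ => ?_
    rw [integral_const_mul, Gam_apply_eq hθ₀]
    ring
  refine Matrix.PosDef.of_dotProduct_mulVec_pos ?_ fun x hx => ?_
  · ext i j
    simp only [Matrix.conjTranspose_apply, star_trivial, Gam_apply_eq hθ₀]
    exact integral_congr_ae (Eventually.of_forall fun ω => mul_comm _ _)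
  · rw [star_trivial, hquad]
    refine lt_of_le_of_ne (integral_nonneg fun _ => sq_nonneg _) fun h0 => hx ?_
    refine hm.eq_zero_of_ae_linear_relation hθ₀ hnd h4 ?_
    have hsqint : Integrable (fun ω => (∑ i, x i * scaledRegressor X θ₀ 0 ω i) ^ 2) μ := by
      refine MemLp.integrable_sq (memLp_finsetSum _ fun i _ => MemLp.const_mul ?_ _)
      exact MemLp.of_bound (hVm i).aestronglyMeasurable (∑ j, (θ₀ j)⁻¹)
        (Eventually.of_forall fun ω => abs_scaledRegressor_le hθ₀ _ _ _)
    have hae := (integral_eq_zero_iff_of_nonneg (fun _ => sq_nonneg _) hsqint).1 h0.symm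
    filter_upwards [hae] with ω hω
    have h1 : ∑ i, x i * scaledRegressor X θ₀ 0 ω i = 0 := (pow_eq_zero_iff two_ne_zero).1 hω
    have h2 : ∑ i, x i * scaledRegressor X θ₀ 0 ω i
        = (∑ i, x i * regressor p X 0 ω i) / sigmaSq X θ₀ (0 + 1) ω := by
      rw [Finset.sum_div]
      exact Finset.sum_congr rfl fun i _ => (mul_div_assoc _ _ _).symm
    rw [h2] at h1
    exact (div_eq_zero_iff.1 h1).resolve_right (sigmaSq_pos X hθ₀ _ ω).ne'

end Model

end ARCH
end

/-! ### The main theorem -/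

theorem theorem1 {Ω : Type*} [MeasurableSpace Ω] (μ : Measure Ω) [IsProbabilityMeasure μ]
    (p : ℕ) (hp : 1 ≤ p)
    (Θ : Set (EuclideanSpace ℝ (Fin (p + 1)))) (θ₀ : EuclideanSpace ℝ (Fin (p + 1)))
    (ε X : ℤ → Ω → ℝ)
    (hmodel : ARCH.IsARCH μ p θ₀ ε X)
    (hreg : ARCH.Regular μ p Θ θ₀ ε X)
    (θLS : ℕ → Ω → EuclideanSpace ℝ (Fin (p + 1)))
    (hLS : ARCH.IsLSEstimator μ p Θ X θLS)
    (hrate : ARCH.IsBoundedInProbability μ (fun n ω => √(n : ℝ) • (θLS n ω - θ₀))) :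
    (ARCH.Gam μ X θ₀).PosDef ∧
      TendstoInDistribution
        (fun (n : ℕ) ω => √(n : ℝ) • (ARCH.efEstimator X n (θLS n ω) ω - θ₀)) atTop
        (id : EuclideanSpace ℝ (Fin (p + 1)) → EuclideanSpace ℝ (Fin (p + 1)))
        (fun _ => μ)
        (multivariateGaussian 0 (Var[fun ω => ε 0 ω ^ 2; μ] • (ARCH.Gam μ X θ₀)⁻¹)) := by
  have hθ₀ : ∀ i, 0 < θ₀ i := hreg.param_pos
  have hΓ := hmodel.posDef_Gam hθ₀ hreg.nondegenerate hreg.fourth_moment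
  refine ⟨hΓ, ?_⟩
  rw [← hmodel.integral_squaredInnovation_sq hθ₀]
  refine ARCH.tendstoInDistribution_of_linear_system
    (V := fun k ω => ARCH.scaledRegressor X θ₀ (k : ℤ) ω)
    (d := fun n ω l => θLS n ω l - θ₀ l) (D := fun n ω => ‖θLS n ω - θ₀‖)
    (hmodel.isInnovation hθ₀ hreg.fourth_moment) (fun k i => ?_)
    (fun k ω i => ARCH.abs_scaledRegressor_le hθ₀ k ω i) hΓ
    (fun i j => hmodel.tendsto_gram hθ₀ i j) (fun n ω i => ?_) ?_ (fun n => ?_)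
    (fun n hn ω hdet => ?_)
  · refine ARCH.measurable_scaledRegressor_apply
      (mΩ := ARCH.natFiltration hmodel.measurable_proc k) (fun s hs => ?_) θ₀ i
    exact ARCH.measurable_past (by omega)
  · simpa using PiLp.norm_apply_le (θLS n ω - θ₀) i
  · simpa [norm_smul, abs_of_nonneg (Real.sqrt_nonneg _)] using hrate.norm
  · have h1 := (ARCH.measurable_efEstimator_uncurry (p := p) hmodel.measurable_proc
      n).comp_aemeasurable ((hLS.aemeasurable n).prodMk aemeasurable_id)
    exact (h1.sub_const θ₀).const_smul (√(n : ℝ))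
  · simp only
    rw [ARCH.efEstimator_sub_eq hθ₀ (θLS n ω) hn ω hdet, Matrix.mulVec_smul]
    rfl
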